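/- **Setting.** Let $\mathcal H$ and $\mathfrak h$ be complex Hilbert spaces, $A:\mathscr D(A)\subseteq\mathcal H\to\mathcal H$ self-adjoint, $\mathcal H_A$ the Hilbert space $\mathscr D(A)$ with inner product $\langle A\phi,A\psi\rangle+\langle\phi,\psi\rangle$, and $\tau:\mathcal H_A\to\mathfrak h$ a bounded surjective linear operator whose kernel $\mathcal N$ is dense in $\mathcal H$. Let $S$ be the restriction of $A$ to $\mathcal N$ and $\mathcal K_\pm:=\mathrm{Ker}(-S^*\pm i)$. For $z\in\rho(A)$ put $R(z):=(-A+z)^{-1}$, $G(z):=(\tau R(\bar z))^*:\mathfrak h\to\mathcal H$, $G_\pm:=G(\pm i)$, $G:=G_-$, $G_*:=\frac12(G_++G_-)$, $\hat\Gamma(z):=\tau(G_*-G(z))$, $\hat\Gamma:=\hat\Gamma(i)=\frac12\tau(G_--G_+)$. For a closed subspace $\mathfrak h_0\subseteq\mathfrak h$ with orthogonal projection $\Pi$ and a self-adjoint operator $\Theta$ in $\mathfrak h_0$ put $\Gamma_{\Pi,\Theta}(z):=\Theta+\Pi\hat\Gamma(z)\Pi$ (an operator in $\mathfrak h_0$ with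 domain $\mathscr D(\Theta)$) and $Z_{\Pi,\Theta}:=\{z\in\rho(A):0\in\rho(\Gamma_{\Pi,\Theta}(z))\}$. For $z\in Z_{\Pi,\Theta}$ let $A_{\Pi,\Theta}$ be the operator with $$\mathscr D(A_{\Pi,\Theta})=\{\phi\in\mathcal H:\ \phi=\phi_z+G(z)\Pi\,\Gamma_{\Pi,\Theta}(z)^{-1}\Pi\tau\phi_z,\ \phi_z\in\mathscr D(A)\},\qquad(-A_{\Pi,\Theta}+z)\phi=(-A+z)\phi_z .$$ For a unitary $U:\mathcal K_+\to\mathcal K_-$ let $A_U$ be the restriction of $S^*$ to $\mathcal N+\{\phi+U\phi:\phi\in\mathcal K_+\}$. **Theorem.** 1) The operators $G_\pm$ are continuous linear bijections from $\mathfrak h$ onto $\mathcal K_\pm$. Let $\mathfrak h_0$, $\Pi$, $\Theta$ be as above. Then $\mathbb C\setminus\mathbb R\subseteq Z_{\Pi,\Theta}$, the operator $\Theta-\Pi\hat\Gamma\Pi$ in $\mathfrak h_0$ has a bounded inverse on $\mathfrak h_0$, and $$\mathfrak h=\mathfrak h_0\dotplus\mathfrak h_0',\qquad \mathfrak h_0':=\{\zeta\in\mathfrak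 h:\ \langle G_+\xi,G_+\zeta\rangle=0\ \text{ for all }\xi\in\mathfrak h_0\}$$ (an algebraic direct sum, with $\mathfrak h_0'=\mathfrak h_0^\perp$ if $\Pi\hat\Gamma=\hat\Gamma\Pi$). With respect to this decomposition, the linear operator $$U:\mathcal K_+\to\mathcal K_-,\qquad U:=-G_-\big((1+2(\Theta-\Pi\hat\Gamma\Pi)^{-1}\Pi\hat\Gamma\Pi)\oplus 1\big)G_+^{-1}$$ is unitary. If $\Theta$ is bounded, then $\mathscr D(\Theta)=\mathfrak h_0$ and $$U=-G_-\big((\Theta-\Pi\hat\Gamma\Pi)^{-1}(\Theta+\Pi\hat\Gamma\Pi)\oplus 1\big)G_+^{-1}.$$ For every $z\in Z_{\Pi,\Theta}$ the operator $A_{\Pi,\Theta}$ is well defined and self-adjoint, and $A_U=A_{\Pi,\Theta}$. 2) Conversely, let $U:\mathcal K_+\to\mathcal K_-$ be unitary and $\mathcal M:=\mathscr D(A_U)\cap\mathscr D(A)$. Then $\mathcal M$ is closed in $\mathcal H_A$, and there is a continuous (in general not orthogonal) projection $P$ in $\mathfrak h$ with $\mathrm{Ker}(P)=\tau[\mathcal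 M\cap\mathcal N^\perp]$ and $\mathscr R(P)=\tau[\mathcal M^\perp]$ (orthogonal complements in $\mathcal H_A$). The subspace $\mathfrak h_0:=P^*\big[\tau[\mathcal M^\perp]\big]$ is closed and contained in $(\tau[\mathcal M\cap\mathcal N^\perp])^\perp$. Let $\Pi$ be the orthogonal projection onto $\mathfrak h_0$ and $U_A:=(-A+i)(-A-i)^{-1}$. Then $$\Theta:=i\,\Pi G^*(U-U_A)(U+U_A)^{-1}G\Pi,$$ understood as an operator in $\mathfrak h_0$ with $\Theta\zeta=\eta$ if and only if there is $x\in\mathcal K_+$ with $(U+U_A)x=G\zeta$ and $\eta=i\,\Pi G^*(U-U_A)x$ (the operator $U+U_A$ on $\mathcal K_+$ need not be injective), is a well-defined self-adjoint operator. Moreover $\mathbb C\setminus\mathbb R\subseteq Z_{\Pi,\Theta}$ and $A_{\Pi,\Theta}=A_U$, for every $z\in Z_{\Pi,\Theta}$ used to define $A_{\Pi,\Theta}$. -/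

import Mathlib

open scoped ComplexConjugate InnerProductSpace LinearPMap

noncomputable section

namespace KreinVonNeumann

section Operators

variable {E : Type*} [NormedAddCommGroup E] [InnerProductSpace ℂ E]

/-- The everywhere defined bounded operator `B` is a two-sided inverse of the (possibly unbounded)
operator `T : D(T) ⊆ E → E`. -/
def IsBoundedInverse (T : E →ₗ.[ℂ] E) (B : E →L[ℂ] E) : Prop :=
  (∀ x : E, ∃ hx : B x ∈ T.domain, T ⟨B x, hx⟩ = x) ∧ ∀ x : T.domain, B (T x) = x

/-- `T : D(T) → E` is bijective with bounded inverse, that is `0 ∈ ρ(T)`. -/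
def HasBoundedInverse (T : E →ₗ.[ℂ] E) : Prop := ∃ B : E →L[ℂ] E, IsBoundedInverse T B

open scoped Classical in
/-- The bounded inverse `T⁻¹ : E → E` of an operator with `0 ∈ ρ(T)` (the value is `0` if
`0 ∉ ρ(T)`). -/
def boundedInverse (T : E →ₗ.[ℂ] E) : E →L[ℂ] E :=
  if h : HasBoundedInverse T then h.choose else 0

/-- The operator `-T + z` with domain `D(T)`. -/
def shift (T : E →ₗ.[ℂ] E) (z : ℂ) : E →ₗ.[ℂ] E := (z • LinearMap.id : E →ₗ[ℂ] E) +ᵥ (-T)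

/-- The resolvent set `ρ(T)`. -/
def resolventSet (T : E →ₗ.[ℂ] E) : Set ℂ := {z | HasBoundedInverse (shift T z)}

/-- The kernel `Ker(-T + z)`, as a subspace of `E`. -/
def kerShift (T : E →ₗ.[ℂ] E) (z : ℂ) : Submodule ℂ E :=
  (LinearMap.ker (shift T z).toFun).map (shift T z).domain.subtype

end Operators

section GraphSpace

variable {H : Type*} [NormedAddCommGroup H] [InnerProductSpace ℂ H]

/-- The space `H_A`: the domain of `A` with the inner product
`⟨φ, ψ⟩_A = ⟨A φ, A ψ⟩ + ⟨φ, ψ⟩`. -/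
def GraphSpace (A : H →ₗ.[ℂ] H) : Type _ := A.domain

variable (A : H →ₗ.[ℂ] H)

instance : AddCommGroup (GraphSpace A) := inferInstanceAs (AddCommGroup A.domain)

instance : Module ℂ (GraphSpace A) := inferInstanceAs (Module ℂ A.domain)

namespace GraphSpace

/-- The inclusion `H_A → H`. -/
def incl : GraphSpace A →ₗ[ℂ] H := A.domain.subtype

/-- The operator `A`, as an everywhere defined operator `H_A → H`. -/
def op : GraphSpace A →ₗ[ℂ] H := A.toFun

theorem incl_injective : Function.Injective (incl A) := Subtype.val_injective

/-- The inner product of `H_A`. -/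
@[reducible]
def core : InnerProductSpace.Core ℂ (GraphSpace A) where
  inner φ ψ := ⟪op A φ, op A ψ⟫_ℂ + ⟪incl A φ, incl A ψ⟫_ℂ
  conj_inner_symm φ ψ := by simp
  re_inner_nonneg φ := by
    have h1 := inner_self_nonneg (𝕜 := ℂ) (x := op A φ)
    have h2 := inner_self_nonneg (𝕜 := ℂ) (x := incl A φ)
    rw [map_add]
    exact add_nonneg h1 h2
  add_left φ ψ χ := by
    simp only [map_add, inner_add_left]
    ring
  smul_left φ ψ r := by
    simp only [map_smul, inner_smul_left]
    ring
  definite φ h := by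
    have h1 := inner_self_nonneg (𝕜 := ℂ) (x := op A φ)
    have h2 := inner_self_nonneg (𝕜 := ℂ) (x := incl A φ)
    have h3 := congrArg RCLike.re h
    rw [map_add, map_zero] at h3
    have h4 : RCLike.re ⟪incl A φ, incl A φ⟫_ℂ = 0 := by linarith
    rw [inner_self_eq_norm_sq, sq_eq_zero_iff, norm_eq_zero] at h4
    exact incl_injective A (by rw [h4, map_zero])

instance : NormedAddCommGroup (GraphSpace A) :=
  @InnerProductSpace.Core.toNormedAddCommGroup ℂ _ _ _ _ (core A)

instance : InnerProductSpace ℂ (GraphSpace A) := InnerProductSpace.ofCore (core A).1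

theorem inner_def (φ ψ : GraphSpace A) :
    ⟪φ, ψ⟫_ℂ = ⟪op A φ, op A ψ⟫_ℂ + ⟪incl A φ, incl A ψ⟫_ℂ := rfl

theorem norm_sq (φ : GraphSpace A) : ‖φ‖ ^ 2 = ‖op A φ‖ ^ 2 + ‖incl A φ‖ ^ 2 := by
  rw [← inner_self_eq_norm_sq (𝕜 := ℂ) φ, inner_def, map_add, inner_self_eq_norm_sq,
    inner_self_eq_norm_sq]

theorem norm_le (φ : GraphSpace A) : ‖φ‖ ≤ ‖op A φ‖ + ‖incl A φ‖ := by
  refine abs_le_of_sq_le_sq' ?_ (by positivity) |>.2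
  rw [norm_sq]
  nlinarith [norm_nonneg (op A φ), norm_nonneg (incl A φ)]

end GraphSpace

theorem resolvent_aux {A : H →ₗ.[ℂ] H} {z : ℂ} (hz : z ∈ resolventSet A) (x : H) :
    boundedInverse (shift A z) x ∈ A.domain ∧
      ∀ h : boundedInverse (shift A z) x ∈ A.domain,
        A ⟨_, h⟩ = z • boundedInverse (shift A z) x - x := by
  have hz' : HasBoundedInverse (shift A z) := hz
  have hB : IsBoundedInverse (shift A z) (boundedInverse (shift A z)) := by
    rw [boundedInverse, dif_pos hz']
    exact hz'.choose_spec
  obtain ⟨h1, h2⟩ := hB.1 x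
  refine ⟨h1, fun h => ?_⟩
  have h3 : z • boundedInverse (shift A z) x - A ⟨_, h⟩ = x := by
    rw [sub_eq_add_neg]
    exact h2
  exact eq_sub_of_add_eq' (sub_eq_iff_eq_add.mp h3).symm

open scoped Classical in
/-- The resolvent `R(z) = (-A + z)⁻¹` for `z ∈ ρ(A)`, as a bounded operator from `H` to `H_A`
(the value is `0` if `z ∉ ρ(A)`). -/
def resolvent (A : H →ₗ.[ℂ] H) (z : ℂ) : H →L[ℂ] GraphSpace A :=
  if hz : z ∈ resolventSet A then
    LinearMap.mkContinuous
      (LinearMap.codRestrict A.domain (boundedInverse (shift A z)).toLinearMap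
        (fun x => (resolvent_aux hz x).1) : H →ₗ[ℂ] GraphSpace A)
      (‖z‖ * ‖boundedInverse (shift A z)‖ + 1 + ‖boundedInverse (shift A z)‖)
      (by
        intro x
        refine (GraphSpace.norm_le A _).trans ?_
        have h1 := (resolvent_aux hz x).2 (resolvent_aux hz x).1
        have h2 := (boundedInverse (shift A z)).le_opNorm x
        have h3 : ‖A ⟨_, (resolvent_aux hz x).1⟩‖ ≤
            ‖z‖ * (‖boundedInverse (shift A z)‖ * ‖x‖) + ‖x‖ := by
          rw [h1]
          refine (norm_sub_le _ _).trans ?_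
          rw [norm_smul]
          gcongr
        have h4 := add_le_add h3 h2
        refine h4.trans (le_of_eq ?_)
        ring)
  else 0

end GraphSpace

section Extensions

variable {H : Type*} [NormedAddCommGroup H] [InnerProductSpace ℂ H] [CompleteSpace H]
variable {𝔥 : Type*} [NormedAddCommGroup 𝔥] [InnerProductSpace ℂ 𝔥] [CompleteSpace 𝔥]

/-- The operator `S`: the restriction of `A` to the kernel `N` of `τ`. -/
def restriction {A : H →ₗ.[ℂ] H} (τ : GraphSpace A →L[ℂ] 𝔥) : H →ₗ.[ℂ] H :=
  A.domRestrict ((LinearMap.ker τ.toLinearMap).map (GraphSpace.incl A))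

/-- The deficiency space `Ker(-S* + z)`; the spaces `K_±` are the cases `z = ± i`. -/
def deficiencySpace {A : H →ₗ.[ℂ] H} (τ : GraphSpace A →L[ℂ] 𝔥) (z : ℂ) : Submodule ℂ H :=
  kerShift (restriction τ)† z

/-- The extension `A_U` of von Neumann's theory: the restriction of `S*` to
`N + {φ + U φ : φ ∈ K_+}`. -/
def vonNeumannExtension {A : H →ₗ.[ℂ] H} (τ : GraphSpace A →L[ℂ] 𝔥)
    (U : deficiencySpace τ Complex.I ≃ₗᵢ[ℂ] deficiencySpace τ (-Complex.I)) : H →ₗ.[ℂ] H :=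
  (restriction τ)†.domRestrict
    ((restriction τ).domain ⊔
      LinearMap.range ((deficiencySpace τ Complex.I).subtype +
        (deficiencySpace τ (-Complex.I)).subtype ∘ₗ U.toLinearEquiv.toLinearMap))

/-- The operator `G(z) = (τ R(z̄))* : 𝔥 → H`. -/
def G {A : H →ₗ.[ℂ] H} (τ : GraphSpace A →L[ℂ] 𝔥) (z : ℂ) : 𝔥 →L[ℂ] H :=
  ContinuousLinearMap.adjoint (τ ∘L resolvent A (conj z))

/-- The operator `G_* = (G(-i) + G(i)) / 2`. -/
def Gstar {A : H →ₗ.[ℂ] H} (τ : GraphSpace A →L[ℂ] 𝔥) : 𝔥 →L[ℂ] H :=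
  (1 / 2 : ℂ) • (G τ (-Complex.I) + G τ Complex.I)

open scoped Classical in
/-- The operator `Γ̂(z) = τ (G_* - G(z)) : 𝔥 → 𝔥`. If `A` is self-adjoint and `z ∈ ρ(A)`, then the
range of `G_* - G(z)` is contained in `D(A)` by the resolvent identity. -/
def gammaHat {A : H →ₗ.[ℂ] H} (τ : GraphSpace A →L[ℂ] 𝔥) (z : ℂ) : 𝔥 →ₗ[ℂ] 𝔥 :=
  if h : ∀ ζ : 𝔥, (Gstar τ - G τ z) ζ ∈ A.domain then
    τ.toLinearMap ∘ₗ
      (LinearMap.codRestrict A.domain (Gstar τ - G τ z).toLinearMap h : 𝔥 →ₗ[ℂ] GraphSpace A)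
  else 0

variable {A : H →ₗ.[ℂ] H} (τ : GraphSpace A →L[ℂ] 𝔥)

/-- The operator `Π Γ̂(z) Π` on `𝔥₀ = R(Π)`, where `Π` is the orthogonal projection onto `𝔥₀`. -/
def compressedGamma (h₀ : Submodule ℂ 𝔥) [CompleteSpace h₀] (z : ℂ) : h₀ →ₗ[ℂ] h₀ :=
  h₀.orthogonalProjectionOnto.toLinearMap ∘ₗ gammaHat τ z ∘ₗ h₀.subtype

/-- The operator `Γ_{Π,Θ}(z) = Θ + Π Γ̂(z) Π` with domain `D(Θ)` in `𝔥₀`. -/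
def gammaTheta (h₀ : Submodule ℂ 𝔥) [CompleteSpace h₀] (Θ : h₀ →ₗ.[ℂ] h₀) (z : ℂ) :
    h₀ →ₗ.[ℂ] h₀ :=
  compressedGamma τ h₀ z +ᵥ Θ

/-- The set `Z_{Π,Θ} = {z ∈ ρ(A) : 0 ∈ ρ(Γ_{Π,Θ}(z))}`. -/
def zSet (h₀ : Submodule ℂ 𝔥) [CompleteSpace h₀] (Θ : h₀ →ₗ.[ℂ] h₀) : Set ℂ :=
  {z | z ∈ resolventSet A ∧ HasBoundedInverse (gammaTheta τ h₀ Θ z)}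

/-- The map `φ_z ↦ G(z) Π Γ_{Π,Θ}(z)⁻¹ Π τ φ_z` on `D(A)`. -/
def kreinCorrection (h₀ : Submodule ℂ 𝔥) [CompleteSpace h₀] (Θ : h₀ →ₗ.[ℂ] h₀) (z : ℂ) :
    GraphSpace A →ₗ[ℂ] H :=
  (G τ z).toLinearMap ∘ₗ h₀.subtype ∘ₗ (boundedInverse (gammaTheta τ h₀ Θ z)).toLinearMap ∘ₗ
    h₀.orthogonalProjectionOnto.toLinearMap ∘ₗ τ.toLinearMap

/-- The graph of `A_{Π,Θ}`: all pairs `(φ, ψ)` for which there is `φ_z ∈ D(A)` with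
`φ = φ_z + G(z) Π Γ_{Π,Θ}(z)⁻¹ Π τ φ_z` and `-ψ + z φ = (-A + z) φ_z`. -/
def kreinGraph (h₀ : Submodule ℂ 𝔥) [CompleteSpace h₀] (Θ : h₀ →ₗ.[ℂ] h₀) (z : ℂ) :
    Submodule ℂ (H × H) :=
  LinearMap.range
    ((GraphSpace.incl A + kreinCorrection τ h₀ Θ z).prod
      (GraphSpace.op A + z • kreinCorrection τ h₀ Θ z))

/-- The operator `A_{Π,Θ}`, written by means of the point `z ∈ Z_{Π,Θ}`. -/
def kreinExtension (h₀ : Submodule ℂ 𝔥) [CompleteSpace h₀] (Θ : h₀ →ₗ.[ℂ] h₀) (z : ℂ) :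
    H →ₗ.[ℂ] H :=
  (kreinGraph τ h₀ Θ z).toLinearPMap

/-- The operator `Θ - Π Γ̂ Π` with domain `D(Θ)` in `𝔥₀`, where `Γ̂ = Γ̂(i)`. -/
def thetaMinus (h₀ : Submodule ℂ 𝔥) [CompleteSpace h₀] (Θ : h₀ →ₗ.[ℂ] h₀) : h₀ →ₗ.[ℂ] h₀ :=
  (-compressedGamma τ h₀ Complex.I) +ᵥ Θ

/-- The complement of `𝔥₀` in `𝔥` with respect to the inner product `⟨G_+ ζ, G_+ ξ⟩`, that is the
preimage under `G_+` of the orthogonal complement of `G_+ 𝔥₀` in `H`. -/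
def deficiencyComplement (h₀ : Submodule ℂ 𝔥) : Submodule ℂ 𝔥 :=
  ((h₀.map (G τ Complex.I).toLinearMap)ᗮ).comap (G τ Complex.I).toLinearMap

/-- The Cayley transform `U_A = (-A + i)(-A - i)⁻¹`. -/
def cayley (A : H →ₗ.[ℂ] H) : H →ₗ[ℂ] H :=
  (-GraphSpace.op A + Complex.I • GraphSpace.incl A) ∘ₗ (resolvent A (-Complex.I)).toLinearMap

/-- The subspace `M = D(A_U) ∩ D(A)` of `H_A`. -/
def commonDomain (U : deficiencySpace τ Complex.I ≃ₗᵢ[ℂ] deficiencySpace τ (-Complex.I)) :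
    Submodule ℂ (GraphSpace A) :=
  (vonNeumannExtension τ U).domain.comap (GraphSpace.incl A)

end Extensions

end KreinVonNeumann

end

noncomputable section

namespace KreinVonNeumann

/-! ### Graphs, adjoints and bounded inverses of unbounded operators. -/

section UnboundedOperators

variable {E : Type*} [NormedAddCommGroup E] [InnerProductSpace ℂ E]

/-! Both families of extensions are restrictions of `S*`, so it suffices to compare boundary
conditions. Every element of `D(S*)` is uniquely `φ + G_* ζ` with `φ ∈ D(A)`, and Green's formula
(`green`) reads `⟨S*(ψ + G_* η), φ + G_* ζ⟩ - ⟨ψ + G_* η, S*(φ + G_* ζ)⟩ = ⟨η, τφ⟩ - ⟨τψ, ζ⟩`, so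
`(ζ, τφ)` is the pair of boundary values. Replacing `G(z)` by `G_*` in the definition of `A_{Π,Θ}`
turns it into the `z`-free condition `ζ ∈ D(Θ)`, `Πτφ = Θζ` (`mem_kreinGraph_iff`), and its
self-adjointness is Green's formula combined with that of `Θ`.

Write a unitary as `U = -G_- W G_+⁻¹` with `W` a bijection of `𝔥`. Since `G_+ ζ - G_- η = G_*(ζ - η)
- (G_* - G_+)(ζ + η)`, the boundary values of `A_U` are exactly the pairs `(ζ - Wζ, -Γ̂(ζ + Wζ))`
(`mem_vonNeumannExtension_graph_iff`). Thus `W` and `Θ` are related by a Cayley transform with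
weight `Γ̂`. The identity `⟨ζ, Γ̂η⟩ = i⟨G_+ ζ, G_+ η⟩` makes `Γ̂` skew with coercive imaginary part:
this gives all the bounded inverses (`hasBoundedInverse_vadd`), and `U` is isometric exactly when
`W` preserves `⟨·, Γ̂ ·⟩`.

From `Θ` to `U`, the relation is solved by `W = 1 + 2(Θ - ΠΓ̂Π)⁻¹ΠΓ̂`. From `U` to `Θ`, the map `1 -
W` may have a kernel. If `m` is the image under `Γ̂` of the fixed points of `W`, then `m = τ[M]`,
the range of `1 - W` is dense in `m^⊥`, and the compression of the inverse Cayley transform to `m^⊥`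
is single valued and self-adjoint (`exists_isSelfAdjoint_inverse_cayley`). For a bounded projection
`P` with kernel `m` one has `P*[R(P)] = m^⊥`, so this space is the required `𝔥₀`. -/

theorem mem_vadd_graph {T : E →ₗ.[ℂ] E} {B : E →ₗ[ℂ] E} {x y : E} :
    (x, y) ∈ (B +ᵥ T).graph ↔ (x, y - B x) ∈ T.graph := by
  simp only [LinearPMap.mem_graph_iff]
  constructor
  · rintro ⟨u, rfl, rfl⟩
    exact ⟨u, rfl, by rw [LinearPMap.vadd_apply]; simp⟩
  · rintro ⟨u, rfl, h⟩
    exact ⟨u, rfl, by rw [LinearPMap.vadd_apply, h]; simp⟩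

theorem mem_neg_graph {T : E →ₗ.[ℂ] E} {x y : E} :
    (x, y) ∈ (-T).graph ↔ (x, -y) ∈ T.graph := by
  simp only [LinearPMap.mem_graph_iff]
  constructor
  · rintro ⟨u, rfl, rfl⟩
    exact ⟨u, rfl, by rw [LinearPMap.neg_apply, neg_neg]⟩
  · rintro ⟨u, rfl, h⟩
    exact ⟨u, rfl, by rw [LinearPMap.neg_apply, h, neg_neg]⟩

theorem mem_shift_graph {T : E →ₗ.[ℂ] E} {z : ℂ} {x y : E} :
    (x, y) ∈ (shift T z).graph ↔ (x, z • x - y) ∈ T.graph := by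
  rw [shift, mem_vadd_graph, mem_neg_graph]
  simp

theorem isBoundedInverse_iff {T : E →ₗ.[ℂ] E} {B : E →L[ℂ] E} :
    IsBoundedInverse T B ↔
      (∀ x, (B x, x) ∈ T.graph) ∧ ∀ x y, (x, y) ∈ T.graph → B y = x := by
  simp only [IsBoundedInverse, LinearPMap.mem_graph_iff]
  constructor
  · rintro ⟨h1, h2⟩
    refine ⟨fun x => ?_, ?_⟩
    · obtain ⟨hx, h⟩ := h1 x
      exact ⟨⟨B x, hx⟩, rfl, h⟩
    · rintro _ _ ⟨u, rfl, rfl⟩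
      exact h2 u
  · rintro ⟨h1, h2⟩
    refine ⟨fun x => ?_, fun x => h2 _ _ ⟨x, rfl, rfl⟩⟩
    obtain ⟨⟨u, hu⟩, h, h'⟩ := h1 x
    simp only at h
    subst h
    exact ⟨hu, h'⟩

theorem HasBoundedInverse.isBoundedInverse {T : E →ₗ.[ℂ] E} (h : HasBoundedInverse T) :
    IsBoundedInverse T (boundedInverse T) := by
  rw [boundedInverse, dif_pos h]
  exact h.choose_spec

theorem HasBoundedInverse.mem_graph {T : E →ₗ.[ℂ] E} (h : HasBoundedInverse T) (x : E) :
    (boundedInverse T x, x) ∈ T.graph :=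
  (isBoundedInverse_iff.1 h.isBoundedInverse).1 x

theorem HasBoundedInverse.apply_eq {T : E →ₗ.[ℂ] E} (h : HasBoundedInverse T) {x y : E}
    (hxy : (x, y) ∈ T.graph) : boundedInverse T y = x :=
  (isBoundedInverse_iff.1 h.isBoundedInverse).2 x y hxy

variable [CompleteSpace E]

theorem mem_adjoint_graph {T : E →ₗ.[ℂ] E} (hT : Dense (T.domain : Set E)) {y w : E} :
    (y, w) ∈ T†.graph ↔ ∀ x v, (x, v) ∈ T.graph → ⟪w, x⟫_ℂ = ⟪y, v⟫_ℂ := by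
  simp only [LinearPMap.mem_graph_iff]
  constructor
  · rintro ⟨u, rfl, rfl⟩ _ _ ⟨x, rfl, rfl⟩
    exact LinearPMap.adjoint_isFormalAdjoint hT u x
  · intro h
    have h' : ∀ x : T.domain, ⟪w, x⟫_ℂ = ⟪y, T x⟫_ℂ := fun x => h _ _ ⟨x, rfl, rfl⟩
    exact ⟨⟨y, LinearPMap.mem_adjoint_domain_of_exists y ⟨w, h'⟩⟩, rfl,
      LinearPMap.adjoint_apply_eq hT _ h'⟩

theorem mem_graph_of_isSelfAdjoint {T : E →ₗ.[ℂ] E} (hT : IsSelfAdjoint T) {y w : E} :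
    (y, w) ∈ T.graph ↔ ∀ x v, (x, v) ∈ T.graph → ⟪w, x⟫_ℂ = ⟪y, v⟫_ℂ := by
  rw [← mem_adjoint_graph hT.dense_domain, LinearPMap.isSelfAdjoint_def.1 hT]

theorem isSelfAdjoint_of_graph {T : E →ₗ.[ℂ] E} (hT : Dense (T.domain : Set E))
    (h : ∀ y w, (y, w) ∈ T.graph ↔ ∀ x v, (x, v) ∈ T.graph → ⟪w, x⟫_ℂ = ⟪y, v⟫_ℂ) :
    IsSelfAdjoint T := by
  rw [LinearPMap.isSelfAdjoint_def]
  refine LinearPMap.eq_of_eq_graph ?_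
  ext ⟨y, w⟩
  rw [mem_adjoint_graph hT, h]

theorem isSelfAdjoint_neg {T : E →ₗ.[ℂ] E} (hT : IsSelfAdjoint T) : IsSelfAdjoint (-T) := by
  refine isSelfAdjoint_of_graph hT.dense_domain fun y w => ?_
  rw [mem_neg_graph, mem_graph_of_isSelfAdjoint hT]
  constructor
  · intro h x v hx
    have := h x (-v) (mem_neg_graph.1 hx)
    simpa using this
  · intro h x v hx
    have := h x (-v) (mem_neg_graph.2 (by simpa using hx))
    rw [inner_neg_left, this, inner_neg_right, neg_neg]

/-- The quadratic form of a self-adjoint operator is real. -/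
theorem inner_im_eq_zero {T : E →ₗ.[ℂ] E} (hT : IsSelfAdjoint T) {x y : E}
    (h : (x, y) ∈ T.graph) : (⟪x, y⟫_ℂ).im = 0 := by
  have h1 := (mem_graph_of_isSelfAdjoint hT).1 h x y h
  have h2 := inner_conj_symm (𝕜 := ℂ) x y
  rw [h1] at h2
  exact Complex.conj_eq_iff_im.1 h2

/-- A perturbation of a self-adjoint operator by a bounded operator with coercive imaginary part
has a bounded inverse. -/
theorem hasBoundedInverse_vadd {T : E →ₗ.[ℂ] E} (hT : IsSelfAdjoint T) (B : E →L[ℂ] E) {c : ℝ}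
    (hc : 0 < c) (hB : ∀ x, c * ‖x‖ ^ 2 ≤ |(⟪x, B x⟫_ℂ).im|) :
    HasBoundedInverse (B.toLinearMap +ᵥ T) := by
  have hclosed : IsClosed (T.graph : Set (E × E)) := hT.isClosed
  have : CompleteSpace T.graph := hclosed.completeSpace_coe
  let f : T.graph →L[ℂ] E :=
    (B ∘L ContinuousLinearMap.fst ℂ E E + ContinuousLinearMap.snd ℂ E E) ∘L T.graph.subtypeL
  have hf : ∀ p : T.graph, f p = B p.1.1 + p.1.2 := fun _ => rfl
  -- The form of `T` is real, so `⟨x, Bx + Tx⟩` has the imaginary part of `⟨x, Bx⟩`; Cauchy-Schwarz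
  -- then bounds `x`, and afterwards `Tx = f p - Bx` is bounded as well.
  have hbelow : ∀ p : T.graph, c * ‖p.1.1‖ ≤ ‖f p‖ := by
    intro p
    rcases eq_or_ne p.1.1 0 with h0 | h0
    · rw [h0, norm_zero, mul_zero]
      exact norm_nonneg _
    · have h1 : (⟪p.1.1, f p⟫_ℂ).im = (⟪p.1.1, B p.1.1⟫_ℂ).im := by
        rw [hf, inner_add_right, Complex.add_im, inner_im_eq_zero hT p.2, add_zero]
      have h2 := hB p.1.1
      rw [← h1] at h2
      have h3 := h2.trans ((Complex.abs_im_le_norm _).trans (norm_inner_le_norm _ _))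
      have h4 : 0 < ‖p.1.1‖ := norm_pos_iff.2 h0
      refine le_of_mul_le_mul_left ?_ h4
      nlinarith
  have hbelow' : ∀ p : T.graph, ‖p‖ ≤ (c⁻¹ + 1 + ‖B‖ * c⁻¹) * ‖f p‖ := by
    intro p
    have h1 : ‖p.1.1‖ ≤ c⁻¹ * ‖f p‖ := by
      rw [inv_mul_eq_div, le_div_iff₀ hc, mul_comm]
      exact hbelow p
    have h2 : ‖p.1.2‖ ≤ ‖f p‖ + ‖B‖ * (c⁻¹ * ‖f p‖) := by
      have : p.1.2 = f p - B p.1.1 := by rw [hf]; abel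
      rw [this]
      refine (norm_sub_le _ _).trans ?_
      gcongr
      exact (B.le_opNorm _).trans (by gcongr)
    have h3 : 0 ≤ ‖f p‖ := norm_nonneg _
    have h4 : 0 ≤ c⁻¹ * ‖f p‖ := by positivity
    have h5 : 0 ≤ ‖B‖ * (c⁻¹ * ‖f p‖) := by positivity
    rw [show ‖p‖ = max ‖p.1.1‖ ‖p.1.2‖ from rfl]
    refine max_le ?_ ?_ <;> nlinarith
  have hinj : LinearMap.ker f.toLinearMap = ⊥ := by
    rw [LinearMap.ker_eq_bot']
    intro p hp
    have := hbelow' p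
    rw [show f p = 0 from hp, norm_zero, mul_zero] at this
    exact norm_le_zero_iff.1 this
  have hK : 0 ≤ c⁻¹ + 1 + ‖B‖ * c⁻¹ := by positivity
  have hanti : AntilipschitzWith (⟨c⁻¹ + 1 + ‖B‖ * c⁻¹, hK⟩ : NNReal) f :=
    AddMonoidHomClass.antilipschitz_of_bound f hbelow'
  have hrc : IsClosed (Set.range f) := hanti.isClosed_range f.uniformContinuous
  have hsurj : LinearMap.range f.toLinearMap = ⊤ := by
    have hrc' : IsClosed ((LinearMap.range f.toLinearMap : Submodule ℂ E) : Set E) := by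
      exact hrc
    have : CompleteSpace (LinearMap.range f.toLinearMap) := hrc'.completeSpace_coe
    rw [← Submodule.orthogonal_eq_bot_iff, Submodule.eq_bot_iff]
    intro y hy
    rw [Submodule.mem_orthogonal'] at hy
    have hy' : ∀ x v, (x, v) ∈ T.graph → ⟪y, B x + v⟫_ℂ = 0 := fun x v h =>
      hy _ ⟨⟨(x, v), h⟩, rfl⟩
    -- Orthogonality to the range says `y ∈ D(T*) = D(T)` with `T y = -B* y`. As `⟨y, Ty⟩` is real
    -- and `y` is orthogonal to `By + Ty`, the imaginary part of `⟨y, By⟩` vanishes, and coercivity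
    -- gives `y = 0`.
    have h1 : (y, -(ContinuousLinearMap.adjoint B y)) ∈ T.graph := by
      rw [mem_graph_of_isSelfAdjoint hT]
      intro x v h
      have := hy' x v h
      rw [inner_add_right] at this
      rw [inner_neg_left, ContinuousLinearMap.adjoint_inner_left]
      exact neg_eq_of_add_eq_zero_right this
    have h2 := hy' _ _ h1
    have h3 := hB y
    have h4 := congrArg Complex.im h2
    rw [inner_add_right, Complex.add_im, inner_im_eq_zero hT h1, add_zero, Complex.zero_im] at h4
    rw [h4, abs_zero] at h3
    have h5 : ‖y‖ ^ 2 ≤ 0 := by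
      by_contra h
      exact absurd h3 (not_le.2 (mul_pos hc (not_le.1 h)))
    exact norm_eq_zero.1 (pow_eq_zero_iff two_ne_zero |>.1 (le_antisymm h5 (sq_nonneg _)))
  let e := ContinuousLinearEquiv.ofBijective f hinj hsurj
  refine ⟨ContinuousLinearMap.fst ℂ E E ∘L T.graph.subtypeL ∘L e.symm.toContinuousLinearMap, ?_⟩
  rw [isBoundedInverse_iff]
  constructor
  · intro x
    obtain ⟨p, rfl⟩ := e.surjective x
    have : (p.1.1, e p) ∈ (B.toLinearMap +ᵥ T).graph := by
      rw [mem_vadd_graph]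
      have h1 : e p - B.toLinearMap p.1.1 = p.1.2 := by
        change B p.1.1 + p.1.2 - B p.1.1 = _
        abel
      rw [h1]
      exact p.2
    simpa using this
  · intro x y hxy
    rw [mem_vadd_graph] at hxy
    have h1 : e ⟨_, hxy⟩ = y := by
      change B x + (y - B x) = y
      abel
    rw [← h1]
    simp

/-- The resolvent set of a self-adjoint operator contains all non-real numbers. -/
theorem mem_resolventSet_of_im_ne_zero {T : E →ₗ.[ℂ] E} (hT : IsSelfAdjoint T) {z : ℂ}
    (hz : z.im ≠ 0) : z ∈ resolventSet T := by
  have h := hasBoundedInverse_vadd (isSelfAdjoint_neg hT) (z • ContinuousLinearMap.id ℂ E)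
    (abs_pos.2 hz) (by
      intro x
      have : ⟪x, (z • ContinuousLinearMap.id ℂ E) x⟫_ℂ = z * ((‖x‖ ^ 2 : ℝ) : ℂ) := by
        simp [inner_self_eq_norm_sq_to_K]
      rw [this, Complex.im_mul_ofReal, abs_mul, abs_of_nonneg (sq_nonneg ‖x‖)])
  exact h

theorem conj_mem_resolventSet {T : E →ₗ.[ℂ] E} (hT : IsSelfAdjoint T) {z : ℂ}
    (hz : z ∈ resolventSet T) : conj z ∈ resolventSet T := by
  by_cases h : z.im = 0
  · rwa [Complex.conj_eq_iff_im.2 h]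
  · exact mem_resolventSet_of_im_ne_zero hT (by simpa using h)

/-- A bounded self-adjoint operator is everywhere defined. -/
theorem domain_eq_top_of_bounded {T : E →ₗ.[ℂ] E} (hT : IsSelfAdjoint T) {C : ℝ}
    (hC : ∀ x : T.domain, ‖T x‖ ≤ C * ‖x‖) : T.domain = ⊤ := by
  rw [eq_top_iff]
  intro y _
  let t : T.domain →L[ℂ] E := LinearMap.mkContinuous T.toFun C hC
  -- For bounded `T` the functional `x ↦ ⟨y, Tx⟩` is continuous for every `y`, so the adjoint is
  -- defined everywhere.
  have h : y ∈ T†.domain := by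
    rw [LinearPMap.mem_adjoint_domain_iff]
    have : Continuous ((innerSL ℂ y) ∘L t) := ContinuousLinearMap.continuous _
    exact this
  rwa [LinearPMap.isSelfAdjoint_def.1 hT] at h

end UnboundedOperators

/-! ### The graph space `H_A` and the resolvent. -/

namespace GraphSpace

variable {H : Type*} [NormedAddCommGroup H] [InnerProductSpace ℂ H] {A : H →ₗ.[ℂ] H}

theorem mem_graph (φ : GraphSpace A) : (incl A φ, op A φ) ∈ A.graph :=
  A.mem_graph φ

theorem exists_of_mem_graph {x y : H} (h : (x, y) ∈ A.graph) :
    ∃ φ : GraphSpace A, incl A φ = x ∧ op A φ = y := by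
  obtain ⟨u, h1, h2⟩ := A.mem_graph_iff.1 h
  exact ⟨u, h1, h2⟩

theorem norm_incl_le (φ : GraphSpace A) : ‖incl A φ‖ ≤ ‖φ‖ := by
  refine abs_le_of_sq_le_sq' ?_ (norm_nonneg _) |>.2
  rw [norm_sq]
  nlinarith [sq_nonneg ‖op A φ‖]

theorem norm_op_le (φ : GraphSpace A) : ‖op A φ‖ ≤ ‖φ‖ := by
  refine abs_le_of_sq_le_sq' ?_ (norm_nonneg _) |>.2
  rw [norm_sq]
  nlinarith [sq_nonneg ‖incl A φ‖]

variable (A) in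
/-- The inclusion `H_A → H` as a bounded operator. -/
def inclL : GraphSpace A →L[ℂ] H :=
  (incl A).mkContinuous 1 fun φ => by simpa using norm_incl_le φ

variable (A) in
/-- The operator `A : H_A → H` as a bounded operator. -/
def opL : GraphSpace A →L[ℂ] H :=
  (op A).mkContinuous 1 fun φ => by simpa using norm_op_le φ

@[simp] theorem inclL_apply (φ : GraphSpace A) : inclL A φ = incl A φ := rfl

@[simp] theorem opL_apply (φ : GraphSpace A) : opL A φ = op A φ := rfl

/-- Two bounded operators whose values form pairs in the graph of `A` define a bounded operator
into `H_A`. -/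
theorem exists_lift {E : Type*} [NormedAddCommGroup E] [NormedSpace ℂ E] (f g : E →L[ℂ] H)
    (h : ∀ x, (f x, g x) ∈ A.graph) :
    ∃ F : E →L[ℂ] GraphSpace A, ∀ x, incl A (F x) = f x ∧ op A (F x) = g x := by
  choose F hF using fun x => exists_of_mem_graph (h x)
  let F' : E →ₗ[ℂ] GraphSpace A :=
    { toFun := F
      map_add' := fun x y => incl_injective A (by simp [hF])
      map_smul' := fun c x => incl_injective A (by simp [hF]) }
  refine ⟨F'.mkContinuous (‖g‖ + ‖f‖) fun x => ?_, hF⟩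
  refine (norm_le A _).trans ?_
  change ‖op A (F x)‖ + ‖incl A (F x)‖ ≤ _
  rw [(hF x).1, (hF x).2, add_mul]
  exact add_le_add (g.le_opNorm x) (f.le_opNorm x)

theorem completeSpace [CompleteSpace H] (hA : A.IsClosed) : CompleteSpace (GraphSpace A) := by
  let j : GraphSpace A →L[ℂ] H × H := (inclL A).prod (opL A)
  have hanti : AntilipschitzWith 2 j := by
    refine AddMonoidHomClass.antilipschitz_of_bound j fun φ => ?_
    have h1 : ‖incl A φ‖ ≤ ‖j φ‖ := norm_fst_le (j φ)
    have h2 : ‖op A φ‖ ≤ ‖j φ‖ := norm_snd_le (j φ)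
    have h3 := norm_le A φ
    push_cast
    linarith
  have hr : Set.range j = (A.graph : Set (H × H)) := by
    ext ⟨x, y⟩
    constructor
    · rintro ⟨φ, hφ⟩
      rw [← hφ]
      exact mem_graph φ
    · intro h
      obtain ⟨φ, h1, h2⟩ := exists_of_mem_graph h
      exact ⟨φ, Prod.ext h1 h2⟩
  rw [completeSpace_iff_isComplete_range (hanti.isUniformInducing j.uniformContinuous), hr]
  exact IsClosed.isComplete hA

theorem inner_op_left [CompleteSpace H] (hA : IsSelfAdjoint A) (φ ψ : GraphSpace A) :
    ⟪op A φ, incl A ψ⟫_ℂ = ⟪incl A φ, op A ψ⟫_ℂ :=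
  (mem_graph_of_isSelfAdjoint hA).1 (mem_graph φ) _ _ (mem_graph ψ)

theorem incl_resolvent {z : ℂ} (hz : z ∈ resolventSet A) (x : H) :
    incl A (resolvent A z x) = boundedInverse (shift A z) x := by
  rw [resolvent, dif_pos hz]
  rfl

theorem smul_sub_resolvent {z : ℂ} (hz : z ∈ resolventSet A) (x : H) :
    z • incl A (resolvent A z x) - op A (resolvent A z x) = x := by
  have h1 := mem_shift_graph.1 (HasBoundedInverse.mem_graph hz x)
  rw [← incl_resolvent hz] at h1
  have h2 := A.mem_graph_snd_inj (mem_graph (resolvent A z x)) h1 rfl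
  rw [h2]
  abel

theorem resolvent_smul_sub {z : ℂ} (hz : z ∈ resolventSet A) (φ : GraphSpace A) :
    resolvent A z (z • incl A φ - op A φ) = φ := by
  apply incl_injective A
  rw [incl_resolvent hz]
  refine HasBoundedInverse.apply_eq hz (mem_shift_graph.2 ?_)
  rw [sub_sub_cancel]
  exact mem_graph φ

end GraphSpace

open GraphSpace

/-! ### The operators `G(z)`, the restriction `S` and its deficiency spaces. -/

section Extensions

variable {H : Type*} [NormedAddCommGroup H] [InnerProductSpace ℂ H] [CompleteSpace H]
variable {𝔥 : Type*} [NormedAddCommGroup 𝔥] [InnerProductSpace ℂ 𝔥] [CompleteSpace 𝔥]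
variable {A : H →ₗ.[ℂ] H} {τ : GraphSpace A →L[ℂ] 𝔥}

theorem I_mem_resolventSet (hA : IsSelfAdjoint A) : Complex.I ∈ resolventSet A :=
  mem_resolventSet_of_im_ne_zero hA (by simp)

theorem neg_I_mem_resolventSet (hA : IsSelfAdjoint A) : -Complex.I ∈ resolventSet A :=
  mem_resolventSet_of_im_ne_zero hA (by simp)

/-- `G(z)` is the adjoint of `τ R(z̄)`, and `R(z̄)` undoes `-A + z̄`. This pairing characterizes
`G(z)` and is the source of the later identities for it. -/
theorem inner_G (hA : IsSelfAdjoint A) {z : ℂ} (hz : z ∈ resolventSet A) (ζ : 𝔥)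
    (ψ : GraphSpace A) : ⟪G τ z ζ, conj z • incl A ψ - op A ψ⟫_ℂ = ⟪ζ, τ ψ⟫_ℂ := by
  rw [G, ContinuousLinearMap.adjoint_inner_left, ContinuousLinearMap.comp_apply,
    resolvent_smul_sub (conj_mem_resolventSet hA hz)]

theorem inner_smul_G_sub (hA : IsSelfAdjoint A) {z : ℂ} (hz : z ∈ resolventSet A) (ζ : 𝔥)
    (ψ : GraphSpace A) :
    ⟪z • G τ z ζ, incl A ψ⟫_ℂ - ⟪G τ z ζ, op A ψ⟫_ℂ = ⟪ζ, τ ψ⟫_ℂ := by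
  rw [← inner_G hA hz, inner_sub_right, inner_smul_left, inner_smul_right]

/-- A weak form of the resolvent identity: in the difference of the pairings for `z` and `w` the
term `⟨ζ, τψ⟩` cancels, and self-adjointness of `A` does the rest. -/
theorem G_sub_G_mem_graph (hA : IsSelfAdjoint A) {z w : ℂ} (hz : z ∈ resolventSet A)
    (hw : w ∈ resolventSet A) (ζ : 𝔥) :
    (G τ z ζ - G τ w ζ, z • G τ z ζ - w • G τ w ζ) ∈ A.graph := by
  rw [mem_graph_of_isSelfAdjoint hA]
  intro x v h
  obtain ⟨ψ, rfl, rfl⟩ := exists_of_mem_graph h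
  have h1 := inner_smul_G_sub (τ := τ) hA hz ζ ψ
  have h2 := inner_smul_G_sub (τ := τ) hA hw ζ ψ
  rw [inner_sub_left, inner_sub_left]
  linear_combination h1 - h2

variable (τ) in
/-- The action of `S*` on the range of `G_*`. -/
def adjGstar : 𝔥 →L[ℂ] H := (Complex.I / 2) • (G τ Complex.I - G τ (-Complex.I))

theorem Gstar_apply (ζ : 𝔥) :
    Gstar τ ζ = (1 / 2 : ℂ) • (G τ (-Complex.I) ζ + G τ Complex.I ζ) := rfl

theorem adjGstar_apply (ζ : 𝔥) :
    adjGstar τ ζ = (Complex.I / 2) • (G τ Complex.I ζ - G τ (-Complex.I) ζ) := rfl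

theorem Gstar_sub_G_mem_graph (hA : IsSelfAdjoint A) {z : ℂ} (hz : z ∈ resolventSet A) (ζ : 𝔥) :
    (Gstar τ ζ - G τ z ζ, adjGstar τ ζ - z • G τ z ζ) ∈ A.graph := by
  have h1 := G_sub_G_mem_graph (τ := τ) hA (I_mem_resolventSet hA) hz ζ
  have h2 := G_sub_G_mem_graph (τ := τ) hA (neg_I_mem_resolventSet hA) hz ζ
  have h3 := A.graph.smul_mem (1 / 2 : ℂ) (A.graph.add_mem h1 h2)
  convert h3 using 1
  ext
  · simp only [Gstar_apply, Prod.smul_fst, Prod.fst_add]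
    module
  · simp only [adjGstar_apply, Prod.smul_snd, Prod.snd_add]
    module

/-- The operator `G_* - G(z)` maps into `D(A)`, and composing with `τ` gives `Γ̂(z)`. -/
theorem exists_lift_Gstar_sub_G (hA : IsSelfAdjoint A) {z : ℂ} (hz : z ∈ resolventSet A) :
    ∃ Q : 𝔥 →L[ℂ] GraphSpace A, ∀ ζ, incl A (Q ζ) = Gstar τ ζ - G τ z ζ ∧
      op A (Q ζ) = adjGstar τ ζ - z • G τ z ζ ∧ gammaHat τ z ζ = τ (Q ζ) := by
  obtain ⟨Q, hQ⟩ := exists_lift (Gstar τ - G τ z) (adjGstar τ - z • G τ z)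
    (Gstar_sub_G_mem_graph hA hz)
  refine ⟨Q, fun ζ => ⟨(hQ ζ).1, (hQ ζ).2, ?_⟩⟩
  have h : ∀ ζ : 𝔥, (Gstar τ - G τ z) ζ ∈ A.domain := fun ζ =>
    LinearPMap.mem_domain_of_mem_graph (Gstar_sub_G_mem_graph hA hz ζ)
  rw [gammaHat, dif_pos h]
  change τ _ = τ _
  congr 1
  exact incl_injective A (hQ ζ).1.symm

theorem continuous_gammaHat (hA : IsSelfAdjoint A) {z : ℂ} (hz : z ∈ resolventSet A) :
    Continuous (gammaHat τ z) := by
  obtain ⟨Q, hQ⟩ := exists_lift_Gstar_sub_G (τ := τ) hA hz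
  rw [show (gammaHat τ z : 𝔥 → 𝔥) = τ ∘L Q from funext fun ζ => (hQ ζ).2.2]
  exact (τ ∘L Q).continuous

theorem mem_restriction_graph {x y : H} :
    (x, y) ∈ (restriction τ).graph ↔ ∃ n, τ n = 0 ∧ incl A n = x ∧ op A n = y := by
  rw [LinearPMap.mem_graph_iff]
  constructor
  · rintro ⟨⟨u, hu, hu'⟩, rfl, rfl⟩
    obtain ⟨n, hn, rfl⟩ := hu
    exact ⟨n, hn, rfl, rfl⟩
  · rintro ⟨n, hn, rfl, rfl⟩
    exact ⟨⟨incl A n, ⟨n, hn, rfl⟩, n.2⟩, rfl, rfl⟩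

theorem mem_restriction_domain {x : H} :
    x ∈ (restriction τ).domain ↔ ∃ n, τ n = 0 ∧ incl A n = x := by
  rw [LinearPMap.mem_domain_iff]
  simp only [mem_restriction_graph]
  constructor
  · rintro ⟨_, n, h1, h2, _⟩
    exact ⟨n, h1, h2⟩
  · rintro ⟨n, h1, h2⟩
    exact ⟨_, n, h1, h2, rfl⟩

theorem mem_adjoint_restriction_graph (hN : Dense ((restriction τ).domain : Set H)) {y w : H} :
    (y, w) ∈ (restriction τ)†.graph ↔
      ∀ n, τ n = 0 → ⟪w, incl A n⟫_ℂ = ⟪y, op A n⟫_ℂ := by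
  rw [mem_adjoint_graph hN]
  constructor
  · intro h n hn
    exact h _ _ (mem_restriction_graph.2 ⟨n, hn, rfl, rfl⟩)
  · intro h x v hx
    obtain ⟨n, hn, rfl, rfl⟩ := mem_restriction_graph.1 hx
    exact h n hn

theorem mem_kerShift {T : H →ₗ.[ℂ] H} {z : ℂ} {x : H} :
    x ∈ kerShift T z ↔ (x, z • x) ∈ T.graph := by
  rw [← sub_zero (z • x), ← mem_shift_graph, LinearPMap.mem_graph_iff, kerShift, Submodule.mem_map]
  constructor
  · rintro ⟨u, hu, rfl⟩
    exact ⟨u, rfl, hu⟩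
  · rintro ⟨u, hu, h⟩
    exact ⟨u, h, hu⟩

theorem mem_deficiencySpace (hN : Dense ((restriction τ).domain : Set H)) {z : ℂ} {x : H} :
    x ∈ deficiencySpace τ z ↔ ∀ n, τ n = 0 → ⟪x, conj z • incl A n - op A n⟫_ℂ = 0 := by
  rw [deficiencySpace, mem_kerShift, mem_adjoint_restriction_graph hN]
  refine forall_congr' fun n => imp_congr_right fun _ => ?_
  rw [inner_sub_right, inner_smul_right, inner_smul_left, sub_eq_zero]

/-- A bounded surjection from the graph space has a bounded right inverse. -/
theorem exists_right_inverse (hA : IsSelfAdjoint A) (hτ : Function.Surjective τ) :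
    ∃ σ : 𝔥 →L[ℂ] GraphSpace A, ∀ ζ, τ (σ ζ) = ζ := by
  have : CompleteSpace (GraphSpace A) := completeSpace hA.isClosed
  let K := LinearMap.ker τ.toLinearMap
  have : CompleteSpace K := (ContinuousLinearMap.isClosed_ker τ).completeSpace_coe
  let f : Kᗮ →L[ℂ] 𝔥 := τ ∘L Kᗮ.subtypeL
  have hinj : LinearMap.ker f.toLinearMap = ⊥ := by
    rw [LinearMap.ker_eq_bot']
    intro x hx
    have h1 : (x : GraphSpace A) ∈ K ⊓ Kᗮ := ⟨hx, x.2⟩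
    rw [K.inf_orthogonal_eq_bot, Submodule.mem_bot] at h1
    exact Subtype.ext h1
  have hsurj : LinearMap.range f.toLinearMap = ⊤ := by
    rw [LinearMap.range_eq_top]
    intro ζ
    obtain ⟨φ, rfl⟩ := hτ ζ
    refine ⟨Kᗮ.orthogonalProjectionOnto φ, ?_⟩
    have h1 : τ (φ - Kᗮ.orthogonalProjectionOnto φ) = 0 := by
      have h2 : φ - Kᗮ.starProjection φ ∈ Kᗮᗮ := Submodule.sub_starProjection_mem_orthogonal φ
      rw [Submodule.orthogonal_orthogonal] at h2
      exact h2
    rw [map_sub, sub_eq_zero] at h1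
    exact h1.symm
  let e := ContinuousLinearEquiv.ofBijective f hinj hsurj
  exact ⟨Kᗮ.subtypeL ∘L e.symm.toContinuousLinearMap, fun ζ => e.apply_symm_apply ζ⟩

theorem G_mem_deficiencySpace (hA : IsSelfAdjoint A)
    (hN : Dense ((restriction τ).domain : Set H)) {z : ℂ} (hz : z ∈ resolventSet A) (ζ : 𝔥) :
    G τ z ζ ∈ deficiencySpace τ z := by
  rw [mem_deficiencySpace hN]
  intro n hn
  rw [inner_G hA hz, hn, inner_zero_right]

/-- The operator `G(z)` has a bounded left inverse, which inverts it on the deficiency space. -/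
theorem exists_left_inverse_G (hA : IsSelfAdjoint A) (hτ : Function.Surjective τ)
    (hN : Dense ((restriction τ).domain : Set H)) {z : ℂ} (hz : z ∈ resolventSet A) :
    ∃ L : H →L[ℂ] 𝔥, (∀ ζ, L (G τ z ζ) = ζ) ∧ ∀ x ∈ deficiencySpace τ z, G τ z (L x) = x := by
  have : CompleteSpace (GraphSpace A) := completeSpace hA.isClosed
  obtain ⟨σ, hσ⟩ := exists_right_inverse hA hτ
  -- The adjoint of `T = (-A + z̄)σ` is a left inverse because `⟨G(z)ζ, Tη⟩ = ⟨ζ, τση⟩ = ⟨ζ, η⟩`. On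
  -- the deficiency space it is also a right inverse, since `ψ - στψ` lies in `N`.
  let T : 𝔥 →L[ℂ] H := (conj z • inclL A - opL A) ∘L σ
  have hT : ∀ ζ, T ζ = conj z • incl A (σ ζ) - op A (σ ζ) := fun _ => rfl
  refine ⟨ContinuousLinearMap.adjoint T, fun ζ => ?_, fun x hx => ?_⟩
  · refine ext_inner_right ℂ fun η => ?_
    rw [ContinuousLinearMap.adjoint_inner_left, hT, inner_G hA hz, hσ]
  · refine ext_inner_right ℂ fun y => ?_
    have hz' := conj_mem_resolventSet hA hz
    obtain ⟨ψ, rfl⟩ : ∃ ψ, y = conj z • incl A ψ - op A ψ :=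
      ⟨_, (smul_sub_resolvent hz' y).symm⟩
    rw [inner_G hA hz, ContinuousLinearMap.adjoint_inner_left, hT]
    have h1 := (mem_deficiencySpace hN).1 hx (ψ - σ (τ ψ)) (by rw [map_sub, hσ, sub_self])
    rw [← sub_eq_zero, ← neg_eq_zero, ← h1, ← inner_sub_right, ← inner_neg_right]
    congr 1
    simp only [map_sub]
    module

theorem G_injective (hA : IsSelfAdjoint A) (hτ : Function.Surjective τ)
    (hN : Dense ((restriction τ).domain : Set H)) {z : ℂ} (hz : z ∈ resolventSet A) :
    Function.Injective (G τ z) := by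
  obtain ⟨L, hL, -⟩ := exists_left_inverse_G hA hτ hN hz
  exact Function.LeftInverse.injective hL

theorem range_G (hA : IsSelfAdjoint A) (hτ : Function.Surjective τ)
    (hN : Dense ((restriction τ).domain : Set H)) {z : ℂ} (hz : z ∈ resolventSet A) :
    LinearMap.range (G τ z).toLinearMap = deficiencySpace τ z := by
  obtain ⟨L, -, hL⟩ := exists_left_inverse_G hA hτ hN hz
  refine le_antisymm ?_ fun x hx => ⟨L x, hL x hx⟩
  rintro _ ⟨ζ, rfl⟩
  exact G_mem_deficiencySpace hA hN hz ζ

theorem exists_norm_le_G (hA : IsSelfAdjoint A) (hτ : Function.Surjective τ)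
    (hN : Dense ((restriction τ).domain : Set H)) {z : ℂ} (hz : z ∈ resolventSet A) :
    ∃ c > 0, ∀ ζ, c * ‖ζ‖ ^ 2 ≤ ‖G τ z ζ‖ ^ 2 := by
  obtain ⟨L, hL, -⟩ := exists_left_inverse_G hA hτ hN hz
  refine ⟨((‖L‖ + 1) ^ 2)⁻¹, by positivity, fun ζ => ?_⟩
  have h1 : ‖ζ‖ ≤ (‖L‖ + 1) * ‖G τ z ζ‖ := by
    conv_lhs => rw [← hL ζ]
    refine (L.le_opNorm _).trans ?_
    nlinarith [norm_nonneg (G τ z ζ)]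
  rw [inv_mul_le_iff₀ (by positivity), ← mul_pow]
  gcongr

end Extensions

/-! ### Green's formula, coercivity of `Γ̂(z)` and the domain of `S*`. -/

section BoundaryForms

variable {H : Type*} [NormedAddCommGroup H] [InnerProductSpace ℂ H] [CompleteSpace H]
variable {𝔥 : Type*} [NormedAddCommGroup 𝔥] [InnerProductSpace ℂ 𝔥] [CompleteSpace 𝔥]
variable {A : H →ₗ.[ℂ] H} {τ : GraphSpace A →L[ℂ] 𝔥}

/-- Pair `G_+ ζ` with `(-A - i)(G_* - G_+)η`, which equals `i G_+ η`. -/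
theorem inner_gammaHat (hA : IsSelfAdjoint A) (ζ η : 𝔥) :
    ⟪ζ, gammaHat τ Complex.I η⟫_ℂ = Complex.I * ⟪G τ Complex.I ζ, G τ Complex.I η⟫_ℂ := by
  obtain ⟨Q, hQ⟩ := exists_lift_Gstar_sub_G (τ := τ) hA (I_mem_resolventSet hA)
  obtain ⟨h1, h2, h3⟩ := hQ η
  rw [h3, ← inner_G hA (I_mem_resolventSet hA), ← inner_smul_right, h1, h2, Gstar_apply,
    adjGstar_apply, Complex.conj_I]
  congr 1
  module

/-- The map `G_+ ζ ↦ G_- ζ` is isometric. -/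
theorem inner_G_neg_I (hA : IsSelfAdjoint A) (ζ η : 𝔥) :
    ⟪G τ (-Complex.I) ζ, G τ (-Complex.I) η⟫_ℂ = ⟪G τ Complex.I ζ, G τ Complex.I η⟫_ℂ := by
  have h := inner_gammaHat (τ := τ) hA ζ η
  obtain ⟨Q, hQ⟩ := exists_lift_Gstar_sub_G (τ := τ) hA (I_mem_resolventSet hA)
  obtain ⟨h1, h2, h3⟩ := hQ η
  have h4 : conj (-Complex.I) • incl A (Q η) - op A (Q η) =
      Complex.I • G τ (-Complex.I) η := by
    rw [h1, h2, Gstar_apply, adjGstar_apply, map_neg, Complex.conj_I]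
    module
  rw [h3, ← inner_G hA (neg_I_mem_resolventSet hA), h4, inner_smul_right] at h
  exact mul_left_cancel₀ Complex.I_ne_zero h

/-- `S*` is symmetric on the range of `G_*`: this is the reason for averaging `G_+` and `G_-`, the
diagonal terms cancelling because `G_+` and `G_-` induce the same inner product on `𝔥`. Hence
Green's formula has no term in `ζ` and `η` alone. -/
theorem inner_adjGstar_Gstar (hA : IsSelfAdjoint A) (ζ η : 𝔥) :
    ⟪adjGstar τ ζ, Gstar τ η⟫_ℂ = ⟪Gstar τ ζ, adjGstar τ η⟫_ℂ := by
  have h := inner_G_neg_I (τ := τ) hA ζ η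
  simp only [adjGstar_apply, Gstar_apply, inner_smul_left, inner_smul_right, inner_add_left,
    inner_add_right, inner_sub_left, inner_sub_right, map_div₀, Complex.conj_I, map_one,
    map_ofNat, h]
  ring

theorem inner_adjGstar_sub (hA : IsSelfAdjoint A) (ζ : 𝔥) (ψ : GraphSpace A) :
    ⟪adjGstar τ ζ, incl A ψ⟫_ℂ - ⟪Gstar τ ζ, op A ψ⟫_ℂ = ⟪ζ, τ ψ⟫_ℂ := by
  have h1 := inner_smul_G_sub (τ := τ) hA (I_mem_resolventSet hA) ζ ψ
  have h2 := inner_smul_G_sub (τ := τ) hA (neg_I_mem_resolventSet hA) ζ ψ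
  simp only [adjGstar_apply, Gstar_apply, inner_smul_left, inner_add_left, inner_sub_left,
    map_div₀, Complex.conj_I, map_one, map_ofNat, map_neg] at h1 h2 ⊢
  linear_combination (1 / 2) * h1 + (1 / 2) * h2

/-- Green's formula for `S*`. -/
theorem green (hA : IsSelfAdjoint A) (φ ψ : GraphSpace A) (ζ η : 𝔥) :
    ⟪op A ψ + adjGstar τ η, incl A φ + Gstar τ ζ⟫_ℂ -
      ⟪incl A ψ + Gstar τ η, op A φ + adjGstar τ ζ⟫_ℂ = ⟪η, τ φ⟫_ℂ - ⟪τ ψ, ζ⟫_ℂ := by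
  have h1 := inner_adjGstar_sub (τ := τ) hA η φ
  have h2 := congrArg conj (inner_adjGstar_sub (τ := τ) hA ζ ψ)
  have h3 := inner_adjGstar_Gstar (τ := τ) hA η ζ
  have h4 := inner_op_left hA ψ φ
  simp only [map_sub, inner_conj_symm] at h2
  simp only [inner_add_left, inner_add_right]
  linear_combination h1 - h2 + h3 + h4

/-- Green's formula applied twice to the same vector `G(z)ζ = -(G_* - G(z))ζ + G_* ζ`, an
eigenvector of `S*` for `z` when `ζ ≠ 0` and `G(z)ζ ≠ 0`, with boundary values `ζ` and `-Γ̂(z)ζ`. -/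
theorem im_inner_gammaHat (hA : IsSelfAdjoint A) {z : ℂ} (hz : z ∈ resolventSet A) (ζ : 𝔥) :
    (⟪ζ, gammaHat τ z ζ⟫_ℂ).im = z.im * ‖G τ z ζ‖ ^ 2 := by
  obtain ⟨Q, hQ⟩ := exists_lift_Gstar_sub_G (τ := τ) hA hz
  obtain ⟨h1, h2, h3⟩ := hQ ζ
  have h := green (τ := τ) hA (-Q ζ) (-Q ζ) ζ ζ
  have h4 : incl A (-Q ζ) + Gstar τ ζ = G τ z ζ := by rw [map_neg, h1]; abel
  have h5 : op A (-Q ζ) + adjGstar τ ζ = z • G τ z ζ := by rw [map_neg, h2]; abel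
  rw [h4, h5, map_neg, ← h3, inner_smul_left, inner_smul_right, inner_neg_right, inner_neg_left,
    ← inner_conj_symm (gammaHat τ z ζ) ζ, inner_self_eq_norm_sq_to_K] at h
  have h6 := congrArg Complex.im h
  have h7 : (((‖G τ z ζ‖ : ℂ)) ^ 2) = ((‖G τ z ζ‖ ^ 2 : ℝ) : ℂ) := by push_cast; rfl
  simp only [Complex.coe_algebraMap, h7, Complex.sub_im, Complex.im_mul_ofReal, Complex.conj_im,
    Complex.neg_im] at h6
  linarith

/-- `Γ̂(z)` has coercive imaginary part for nonreal `z`. -/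
theorem exists_coercive_gammaHat (hA : IsSelfAdjoint A) (hτ : Function.Surjective τ)
    (hN : Dense ((restriction τ).domain : Set H)) {z : ℂ} (hz : z.im ≠ 0) :
    ∃ c > 0, ∀ ζ, c * ‖ζ‖ ^ 2 ≤ |(⟪ζ, gammaHat τ z ζ⟫_ℂ).im| := by
  have hz' := mem_resolventSet_of_im_ne_zero hA hz
  obtain ⟨c, hc, h⟩ := exists_norm_le_G hA hτ hN hz'
  refine ⟨|z.im| * c, mul_pos (abs_pos.2 hz) hc, fun ζ => ?_⟩
  rw [im_inner_gammaHat hA hz', abs_mul, abs_of_nonneg (sq_nonneg ‖G τ z ζ‖), mul_assoc]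
  exact mul_le_mul_of_nonneg_left (h ζ) (abs_nonneg _)

theorem inner_compressedGamma (h₀ : Submodule ℂ 𝔥) [CompleteSpace h₀] (z : ℂ) (ζ η : h₀) :
    ⟪ζ, compressedGamma τ h₀ z η⟫_ℂ = ⟪(ζ : 𝔥), gammaHat τ z η⟫_ℂ :=
  Submodule.inner_orthogonalProjectionOnto_eq_of_mem_left ζ _

/-- The compression of `Γ̂(z)` as a bounded operator, with coercive imaginary part. -/
theorem exists_coercive_compressedGamma (hA : IsSelfAdjoint A) (hτ : Function.Surjective τ)
    (hN : Dense ((restriction τ).domain : Set H)) (h₀ : Submodule ℂ 𝔥) [CompleteSpace h₀] {z : ℂ}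
    (hz : z.im ≠ 0) :
    ∃ B : h₀ →L[ℂ] h₀, B.toLinearMap = compressedGamma τ h₀ z ∧
      ∃ c > 0, ∀ ζ, c * ‖ζ‖ ^ 2 ≤ |(⟪ζ, B ζ⟫_ℂ).im| := by
  obtain ⟨c, hc, h⟩ := exists_coercive_gammaHat hA hτ hN hz
  refine ⟨⟨compressedGamma τ h₀ z, ?_⟩, rfl, c, hc, fun ζ => ?_⟩
  · exact h₀.orthogonalProjectionOnto.continuous.comp
      ((continuous_gammaHat hA (mem_resolventSet_of_im_ne_zero hA hz)).comp continuous_subtype_val)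
  · refine (h ζ).trans (le_of_eq ?_)
    rw [← inner_compressedGamma]
    rfl

theorem mem_zSet_of_im_ne_zero (hA : IsSelfAdjoint A) (hτ : Function.Surjective τ)
    (hN : Dense ((restriction τ).domain : Set H)) (h₀ : Submodule ℂ 𝔥) [CompleteSpace h₀]
    {Θ : h₀ →ₗ.[ℂ] h₀} (hΘ : IsSelfAdjoint Θ) {z : ℂ} (hz : z.im ≠ 0) : z ∈ zSet τ h₀ Θ := by
  obtain ⟨B, hB, c, hc, h⟩ := exists_coercive_compressedGamma hA hτ hN h₀ hz
  refine ⟨mem_resolventSet_of_im_ne_zero hA hz, ?_⟩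
  rw [gammaTheta, ← hB]
  exact hasBoundedInverse_vadd hΘ B hc h

/-- Coercivity concerns the absolute value of the imaginary part, so the sign in front of `ΠΓ̂Π` is
irrelevant. -/
theorem hasBoundedInverse_thetaMinus (hA : IsSelfAdjoint A) (hτ : Function.Surjective τ)
    (hN : Dense ((restriction τ).domain : Set H)) (h₀ : Submodule ℂ 𝔥) [CompleteSpace h₀]
    {Θ : h₀ →ₗ.[ℂ] h₀} (hΘ : IsSelfAdjoint Θ) : HasBoundedInverse (thetaMinus τ h₀ Θ) := by
  obtain ⟨B, hB, c, hc, h⟩ :=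
    exists_coercive_compressedGamma hA hτ hN h₀ (z := Complex.I) (by simp)
  rw [thetaMinus, ← hB]
  refine hasBoundedInverse_vadd hΘ (-B) hc fun ζ => (h ζ).trans (le_of_eq ?_)
  rw [neg_apply, inner_neg_right, Complex.neg_im, abs_neg]

theorem isSelfAdjoint_zero {E : Type*} [NormedAddCommGroup E] [InnerProductSpace ℂ E]
    [CompleteSpace E] : IsSelfAdjoint (0 : E →ₗ.[ℂ] E) := by
  have hg : ∀ x y : E, (x, y) ∈ (0 : E →ₗ.[ℂ] E).graph ↔ y = 0 := by
    intro x y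
    rw [LinearPMap.mem_graph_iff]
    exact ⟨fun ⟨_, _, h⟩ => h.symm, fun h => ⟨⟨x, trivial⟩, rfl, h.symm⟩⟩
  refine isSelfAdjoint_of_graph ?_ fun y w => ?_
  · exact dense_univ
  · simp only [hg]
    constructor
    · rintro rfl x v rfl
      simp
    · intro h
      simpa using h w 0 rfl

/-- The compression of `Γ̂` is bijective with bounded inverse. -/
theorem exists_inverse_compressedGamma (hA : IsSelfAdjoint A) (hτ : Function.Surjective τ)
    (hN : Dense ((restriction τ).domain : Set H)) (h₀ : Submodule ℂ 𝔥) [CompleteSpace h₀] :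
    ∃ B : h₀ →L[ℂ] h₀, (∀ ζ, B (compressedGamma τ h₀ Complex.I ζ) = ζ) ∧
      ∀ ζ, compressedGamma τ h₀ Complex.I (B ζ) = ζ := by
  -- For `Θ = 0` the operator `Θ + ΠΓ̂Π` is the compression itself.
  have h := (mem_zSet_of_im_ne_zero hA hτ hN h₀ isSelfAdjoint_zero (z := Complex.I) (by simp)).2
  have hg : ∀ x y : h₀, (x, y) ∈ (gammaTheta τ h₀ 0 Complex.I).graph ↔
      compressedGamma τ h₀ Complex.I x = y := by
    intro x y
    rw [gammaTheta, mem_vadd_graph, LinearPMap.mem_graph_iff]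
    constructor
    · rintro ⟨_, _, h⟩
      exact (sub_eq_zero.1 h.symm).symm
    · intro h
      exact ⟨⟨x, trivial⟩, rfl, (sub_eq_zero.2 h.symm).symm⟩
  exact ⟨_, fun ζ => h.apply_eq ((hg _ _).2 rfl), fun ζ => (hg _ _).1 (h.mem_graph ζ)⟩

theorem exists_inverse_gammaHat (hA : IsSelfAdjoint A) (hτ : Function.Surjective τ)
    (hN : Dense ((restriction τ).domain : Set H)) :
    ∃ B : 𝔥 →L[ℂ] 𝔥, (∀ ζ, B (gammaHat τ Complex.I ζ) = ζ) ∧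
      ∀ ζ, gammaHat τ Complex.I (B ζ) = ζ := by
  have hT : CompleteSpace (⊤ : Submodule ℂ 𝔥) := isClosed_univ.completeSpace_coe
  obtain ⟨B, hB1, hB2⟩ := exists_inverse_compressedGamma hA hτ hN (⊤ : Submodule ℂ 𝔥)
  have hp : ∀ x : 𝔥, (((⊤ : Submodule ℂ 𝔥).orthogonalProjectionOnto x : (⊤ : Submodule ℂ 𝔥)) : 𝔥) =
      x := fun x => Submodule.starProjection_eq_self_iff.2 Submodule.mem_top
  have hc : ∀ x : (⊤ : Submodule ℂ 𝔥), (compressedGamma τ ⊤ Complex.I x : 𝔥) =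
      gammaHat τ Complex.I x := fun x => hp _
  refine ⟨(⊤ : Submodule ℂ 𝔥).subtypeL ∘L B ∘L (⊤ : Submodule ℂ 𝔥).orthogonalProjectionOnto,
    fun ζ => ?_, fun ζ => ?_⟩
  · have h1 : (⊤ : Submodule ℂ 𝔥).orthogonalProjectionOnto (gammaHat τ Complex.I ζ) =
        compressedGamma τ ⊤ Complex.I ⟨ζ, Submodule.mem_top⟩ := Subtype.ext (by rw [hp, hc])
    change ((B ((⊤ : Submodule ℂ 𝔥).orthogonalProjectionOnto (gammaHat τ Complex.I ζ)) :
      (⊤ : Submodule ℂ 𝔥)) : 𝔥) = ζ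
    rw [h1, hB1]
  · change gammaHat τ Complex.I
      (B ((⊤ : Submodule ℂ 𝔥).orthogonalProjectionOnto ζ) : (⊤ : Submodule ℂ 𝔥)) = ζ
    rw [← hc, hB2, hp]

theorem inner_gammaHat_left (hA : IsSelfAdjoint A) (ζ η : 𝔥) :
    ⟪gammaHat τ Complex.I ζ, η⟫_ℂ = -⟪ζ, gammaHat τ Complex.I η⟫_ℂ := by
  rw [← inner_conj_symm, inner_gammaHat hA, inner_gammaHat hA, map_mul, inner_conj_symm,
    Complex.conj_I, neg_mul]

/-- The graph of `A` is contained in the graph of `S*`. -/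
theorem mem_adjoint_restriction_graph_of_mem (hA : IsSelfAdjoint A)
    (hN : Dense ((restriction τ).domain : Set H)) (φ : GraphSpace A) :
    (incl A φ, op A φ) ∈ (restriction τ)†.graph :=
  (mem_adjoint_restriction_graph hN).2 fun n _ => inner_op_left hA φ n

theorem Gstar_mem_adjoint_restriction_graph (hA : IsSelfAdjoint A)
    (hN : Dense ((restriction τ).domain : Set H)) (ζ : 𝔥) :
    (Gstar τ ζ, adjGstar τ ζ) ∈ (restriction τ)†.graph :=
  (mem_adjoint_restriction_graph hN).2 fun n hn => by
    rw [← sub_eq_zero, inner_adjGstar_sub hA, hn, inner_zero_right]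

/-- The domain of `S*` is `D(A) + R(G_*)`. -/
theorem mem_adjoint_restriction_graph_iff (hA : IsSelfAdjoint A) (hτ : Function.Surjective τ)
    (hN : Dense ((restriction τ).domain : Set H)) {y w : H} :
    (y, w) ∈ (restriction τ)†.graph ↔
      ∃ φ ζ, y = incl A φ + Gstar τ ζ ∧ w = op A φ + adjGstar τ ζ := by
  constructor
  · intro h
    have hI := I_mem_resolventSet hA
    -- Subtracting `R(i)(-S* + i)y` leaves an element `G_+ ζ` of `K_+`; writing `G_+ ζ` as `G_* ζ`
    -- minus `(G_* - G_+)ζ ∈ D(A)` gives the decomposition.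
    let f := resolvent A Complex.I (Complex.I • y - w)
    have hf : Complex.I • incl A f - op A f = Complex.I • y - w := smul_sub_resolvent hI _
    have h1 := (restriction τ)†.graph.sub_mem h (mem_adjoint_restriction_graph_of_mem hA hN f)
    have h2 : y - incl A f ∈ deficiencySpace τ Complex.I := by
      rw [deficiencySpace, mem_kerShift]
      convert h1 using 1
      ext
      · rfl
      · change Complex.I • (y - incl A f) = w - op A f
        linear_combination (norm := module) -hf
    rw [← range_G hA hτ hN hI] at h2
    obtain ⟨ζ, hζ⟩ := h2
    change G τ Complex.I ζ = _ at hζ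
    obtain ⟨Q, hQ⟩ := exists_lift_Gstar_sub_G (τ := τ) hA hI
    obtain ⟨h3, h4, -⟩ := hQ ζ
    refine ⟨f - Q ζ, ζ, ?_, ?_⟩
    · rw [map_sub, h3, hζ]
      abel
    · rw [map_sub, h4, hζ]
      linear_combination (norm := module) hf
  · rintro ⟨φ, ζ, rfl, rfl⟩
    exact (restriction τ)†.graph.add_mem (mem_adjoint_restriction_graph_of_mem hA hN φ)
      (Gstar_mem_adjoint_restriction_graph hA hN ζ)

/-- Otherwise `G_+ ζ` would lie in `D(A)` as well as in `K_+`, so `A G_+ ζ = i G_+ ζ`; but `i ∈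
ρ(A)` and `G_+` is injective. This makes the boundary values well defined. -/
theorem eq_zero_of_incl_add_Gstar_eq_zero (hA : IsSelfAdjoint A) (hτ : Function.Surjective τ)
    (hN : Dense ((restriction τ).domain : Set H)) {φ : GraphSpace A} {ζ : 𝔥}
    (h : incl A φ + Gstar τ ζ = 0) : φ = 0 ∧ ζ = 0 := by
  have hI := I_mem_resolventSet hA
  obtain ⟨Q, hQ⟩ := exists_lift_Gstar_sub_G (τ := τ) hA hI
  have h1 : incl A (-φ - Q ζ) = G τ Complex.I ζ := by
    rw [map_sub, map_neg, (hQ ζ).1, eq_neg_of_add_eq_zero_left h]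
    abel
  have h2 := G_mem_deficiencySpace hA hN hI ζ
  rw [deficiencySpace, mem_kerShift, ← h1] at h2
  have h3 := LinearPMap.mem_graph_snd_inj _ h2
    (mem_adjoint_restriction_graph_of_mem hA hN (-φ - Q ζ)) rfl
  have h4 := resolvent_smul_sub hI (-φ - Q ζ)
  rw [h3, sub_self, map_zero] at h4
  rw [← h4, map_zero] at h1
  have h5 : ζ = 0 := G_injective hA hτ hN hI (by rw [← h1, map_zero])
  refine ⟨?_, h5⟩
  rw [h5, map_zero, add_zero] at h
  exact incl_injective A (by rw [h, map_zero])

theorem incl_add_Gstar_injective (hA : IsSelfAdjoint A) (hτ : Function.Surjective τ)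
    (hN : Dense ((restriction τ).domain : Set H)) {φ ψ : GraphSpace A} {ζ η : 𝔥}
    (h : incl A φ + Gstar τ ζ = incl A ψ + Gstar τ η) : φ = ψ ∧ ζ = η := by
  have h1 := eq_zero_of_incl_add_Gstar_eq_zero hA hτ hN (φ := φ - ψ) (ζ := ζ - η) (by
    rw [map_sub, map_sub, sub_add_sub_comm, h, sub_self])
  exact ⟨sub_eq_zero.1 h1.1, sub_eq_zero.1 h1.2⟩

end BoundaryForms

/-! ### Both kinds of extension in terms of boundary values. -/

section ExtensionGraphs

variable {H : Type*} [NormedAddCommGroup H] [InnerProductSpace ℂ H] [CompleteSpace H]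
variable {𝔥 : Type*} [NormedAddCommGroup 𝔥] [InnerProductSpace ℂ 𝔥] [CompleteSpace 𝔥]
variable {A : H →ₗ.[ℂ] H} {τ : GraphSpace A →L[ℂ] 𝔥}

/-- In terms of boundary values, the graph of `A_{Π,Θ}` does not involve `z`. -/
theorem mem_kreinGraph_iff (hA : IsSelfAdjoint A) {h₀ : Submodule ℂ 𝔥} [CompleteSpace h₀]
    {Θ : h₀ →ₗ.[ℂ] h₀} {z : ℂ} (hz : z ∈ zSet τ h₀ Θ) {x y : H} :
    (x, y) ∈ kreinGraph τ h₀ Θ z ↔ ∃ (φ : GraphSpace A) (ζ : h₀),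
      (ζ, h₀.orthogonalProjectionOnto (τ φ)) ∈ Θ.graph ∧
        x = incl A φ + Gstar τ ζ ∧ y = op A φ + adjGstar τ ζ := by
  obtain ⟨hzA, hzΓ⟩ := hz
  -- With `Q = G_* - G(z)` and `φ = φ_z - Qζ` one has `φ_z + G(z)ζ = φ + G_* ζ`, and `Γ_{Π,Θ}(z)ζ =
  -- Πτφ_z` becomes `Θζ = Πτφ`, because `τQ = Γ̂(z)`.
  obtain ⟨Q, hQ⟩ := exists_lift_Gstar_sub_G (τ := τ) hA hzA
  have hproj : ∀ (ψ : GraphSpace A) (ζ : h₀), h₀.orthogonalProjectionOnto (τ (ψ - Q ζ)) =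
      h₀.orthogonalProjectionOnto (τ ψ) - compressedGamma τ h₀ z ζ := by
    intro ψ ζ
    rw [map_sub, map_sub, ← (hQ ζ).2.2]
    rfl
  have hcorr : ∀ ψ : GraphSpace A, kreinCorrection τ h₀ Θ z ψ =
      G τ z (boundedInverse (gammaTheta τ h₀ Θ z) (h₀.orthogonalProjectionOnto (τ ψ)) : h₀) :=
    fun _ => rfl
  constructor
  · rintro ⟨ψ, hψ⟩
    obtain ⟨rfl, rfl⟩ := Prod.mk.inj hψ
    set ζ : h₀ := boundedInverse (gammaTheta τ h₀ Θ z) (h₀.orthogonalProjectionOnto (τ ψ)) with hζ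
    have h1 := hzΓ.mem_graph (h₀.orthogonalProjectionOnto (τ ψ))
    rw [← hζ, gammaTheta, mem_vadd_graph, ← hproj] at h1
    refine ⟨ψ - Q ζ, ζ, h1, ?_, ?_⟩
    · rw [LinearMap.add_apply, hcorr, map_sub, (hQ ζ).1, ← hζ]
      abel
    · rw [LinearMap.add_apply, LinearMap.smul_apply, hcorr, map_sub, (hQ ζ).2.1, ← hζ]
      abel
  · rintro ⟨φ, ζ, h, rfl, rfl⟩
    have h1 : (ζ, h₀.orthogonalProjectionOnto (τ (φ + Q ζ))) ∈ (gammaTheta τ h₀ Θ z).graph := by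
      rw [gammaTheta, mem_vadd_graph, ← hproj, add_sub_cancel_right]
      exact h
    have h2 := hzΓ.apply_eq h1
    refine ⟨φ + Q ζ, Prod.ext ?_ ?_⟩
    · change incl A (φ + Q ζ) + kreinCorrection τ h₀ Θ z (φ + Q ζ) = incl A φ + Gstar τ ζ
      rw [hcorr, h2, map_add, (hQ ζ).1]
      abel
    · change op A (φ + Q ζ) + z • kreinCorrection τ h₀ Θ z (φ + Q ζ) =
        op A φ + adjGstar τ ζ
      rw [hcorr, h2, map_add, (hQ ζ).2.1]
      abel

theorem kreinExtension_graph (hA : IsSelfAdjoint A) (hτ : Function.Surjective τ)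
    (hN : Dense ((restriction τ).domain : Set H)) {h₀ : Submodule ℂ 𝔥} [CompleteSpace h₀]
    {Θ : h₀ →ₗ.[ℂ] h₀} {z : ℂ} (hz : z ∈ zSet τ h₀ Θ) :
    (kreinExtension τ h₀ Θ z).graph = kreinGraph τ h₀ Θ z := by
  refine Submodule.toLinearPMap_graph_eq _ ?_
  rintro ⟨x, y⟩ hxy hx
  simp only at hx
  obtain ⟨φ, ζ, -, h1, h2⟩ := (mem_kreinGraph_iff hA hz).1 hxy
  obtain ⟨rfl, h3⟩ := eq_zero_of_incl_add_Gstar_eq_zero hA hτ hN (h1.symm.trans hx)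
  simp [h2, h3]

theorem isSelfAdjoint_kreinExtension (hA : IsSelfAdjoint A) (hτ : Function.Surjective τ)
    (hN : Dense ((restriction τ).domain : Set H)) {h₀ : Submodule ℂ 𝔥} [CompleteSpace h₀]
    {Θ : h₀ →ₗ.[ℂ] h₀} (hΘ : IsSelfAdjoint Θ) {z : ℂ} (hz : z ∈ zSet τ h₀ Θ) :
    IsSelfAdjoint (kreinExtension τ h₀ Θ z) := by
  have hg : ∀ φ : GraphSpace A, ∀ ζ : h₀, (ζ, h₀.orthogonalProjectionOnto (τ φ)) ∈ Θ.graph →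
      (incl A φ + Gstar τ ζ, op A φ + adjGstar τ ζ) ∈ (kreinExtension τ h₀ Θ z).graph := by
    intro φ ζ h
    rw [kreinExtension_graph hA hτ hN hz]
    exact (mem_kreinGraph_iff hA hz).2 ⟨φ, ζ, h, rfl, rfl⟩
  have hg0 : ∀ φ : GraphSpace A, τ φ ∈ h₀ᗮ →
      (incl A φ, op A φ) ∈ (kreinExtension τ h₀ Θ z).graph := by
    intro φ h
    have h1 := hg φ 0 (by
      rw [Submodule.orthogonalProjectionOnto_eq_zero_iff.2 h]
      exact Θ.graph.zero_mem)
    simpa using h1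
  refine isSelfAdjoint_of_graph (hN.mono ?_) fun y w => ⟨fun h x v hx => ?_, fun h => ?_⟩
  · intro x hx
    obtain ⟨n, hn, rfl⟩ := mem_restriction_domain.1 hx
    exact LinearPMap.mem_domain_of_mem_graph (hg0 n (by rw [hn]; exact zero_mem _))
  · rw [kreinExtension_graph hA hτ hN hz, mem_kreinGraph_iff hA hz] at h hx
    obtain ⟨ψ, η, h1, rfl, rfl⟩ := h
    obtain ⟨φ, ζ, h2, rfl, rfl⟩ := hx
    rw [← sub_eq_zero, green hA]
    have h3 := (mem_graph_of_isSelfAdjoint hΘ).1 h1 _ _ h2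
    rw [Submodule.inner_orthogonalProjectionOnto_eq_of_mem_left,
      Submodule.inner_orthogonalProjectionOnto_eq_of_mem_right] at h3
    rw [h3, sub_self]
  · have hS : (y, w) ∈ (restriction τ)†.graph := by
      rw [mem_adjoint_restriction_graph hN]
      exact fun n hn => h _ _ (hg0 n (by rw [hn]; exact zero_mem _))
    obtain ⟨ψ, η, rfl, rfl⟩ := (mem_adjoint_restriction_graph_iff hA hτ hN).1 hS
    -- Vectors `φ ∈ D(A)` with `τφ ∈ 𝔥₀^⊥` belong to the extension with `ζ = 0`. Testing against
    -- them forces `η ∈ 𝔥₀^⊥⊥`; testing against the full graph then puts `(η, Πτψ)` into the graph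
    -- of `Θ* = Θ`.
    have hη : η ∈ h₀ := by
      rw [← h₀.orthogonal_orthogonal, Submodule.mem_orthogonal']
      intro u hu
      obtain ⟨φ, rfl⟩ := hτ u
      have h1 := green (τ := τ) hA φ ψ 0 η
      have h2 := h _ _ (hg0 φ hu)
      simp only [map_zero, add_zero, inner_zero_right, sub_zero] at h1
      rw [← h1, h2, sub_self]
    rw [kreinExtension_graph hA hτ hN hz, mem_kreinGraph_iff hA hz]
    refine ⟨ψ, ⟨η, hη⟩, ?_, rfl, rfl⟩
    rw [mem_graph_of_isSelfAdjoint hΘ]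
    intro ζ v hv
    obtain ⟨φ, hφ⟩ := hτ v
    have hφ' : h₀.orthogonalProjectionOnto (τ φ) = v := by
      rw [hφ, Submodule.orthogonalProjectionOnto_mem_subspace_eq_self]
    have h1 := h _ _ (hg φ ζ (by rwa [hφ']))
    rw [← sub_eq_zero, green hA, hφ, sub_eq_zero] at h1
    rw [Submodule.inner_orthogonalProjectionOnto_eq_of_mem_right, ← h1]
    rfl

theorem mem_domRestrict_graph {T : H →ₗ.[ℂ] H} {K : Submodule ℂ H} {x y : H} :
    (x, y) ∈ (T.domRestrict K).graph ↔ x ∈ K ∧ (x, y) ∈ T.graph := by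
  simp only [LinearPMap.mem_graph_iff]
  constructor
  · rintro ⟨⟨u, hu, hu'⟩, rfl, rfl⟩
    exact ⟨hu, ⟨u, hu'⟩, rfl, rfl⟩
  · rintro ⟨hx, ⟨u, hu⟩, rfl, rfl⟩
    exact ⟨⟨u, hx, hu⟩, rfl, rfl⟩

/-- The graph of `A_U` in terms of boundary values, when `U G_+ = -G_- W`. -/
theorem mem_vonNeumannExtension_graph_iff (hA : IsSelfAdjoint A) (hτ : Function.Surjective τ)
    (hN : Dense ((restriction τ).domain : Set H))
    {U : deficiencySpace τ Complex.I ≃ₗᵢ[ℂ] deficiencySpace τ (-Complex.I)} {W : 𝔥 → 𝔥}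
    (hW : ∀ (ζ : 𝔥) (u : deficiencySpace τ Complex.I), (u : H) = G τ Complex.I ζ →
      (U u : H) = -G τ (-Complex.I) (W ζ)) {x y : H} :
    (x, y) ∈ (vonNeumannExtension τ U).graph ↔ ∃ φ ζ,
      τ φ = -gammaHat τ Complex.I (ζ + W ζ) ∧
        x = incl A φ + Gstar τ (ζ - W ζ) ∧ y = op A φ + adjGstar τ (ζ - W ζ) := by
  have hI := I_mem_resolventSet hA
  obtain ⟨Q, hQ⟩ := exists_lift_Gstar_sub_G (τ := τ) hA hI
  -- Passage from von Neumann's decomposition to `D(A) + R(G_*)`, with `Q = G_* - G_+ = (G_- -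
  -- G_+)/2`. Taking `η = Wζ` and `τn = 0` yields the two boundary values.
  have key : ∀ n ζ η, incl A (n - Q (ζ + η)) + Gstar τ (ζ - η) =
      incl A n + (G τ Complex.I ζ + -G τ (-Complex.I) η) := by
    intro n ζ η
    rw [map_sub, (hQ _).1]
    simp only [Gstar_apply, map_add, map_sub]
    module
  rw [vonNeumannExtension, mem_domRestrict_graph, Submodule.mem_sup]
  constructor
  · rintro ⟨⟨_, hn, _, ⟨u, rfl⟩, hx⟩, hxy⟩
    obtain ⟨n, hn', rfl⟩ := mem_restriction_domain.1 hn
    obtain ⟨ζ, hζ⟩ := (range_G hA hτ hN hI).ge u.2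
    change G τ Complex.I ζ = u at hζ
    have hx' : x = incl A (n - Q (ζ + W ζ)) + Gstar τ (ζ - W ζ) := by
      rw [← hx, key, ← hW ζ u hζ.symm, hζ]
      rfl
    refine ⟨n - Q (ζ + W ζ), ζ, ?_, hx', ?_⟩
    · rw [map_sub, hn', ← (hQ _).2.2, zero_sub]
    · exact LinearPMap.mem_graph_snd_inj _ hxy
        ((mem_adjoint_restriction_graph_iff hA hτ hN).2 ⟨_, _, rfl, rfl⟩) hx'
  · rintro ⟨φ, ζ, h, rfl, rfl⟩
    refine ⟨?_, (mem_adjoint_restriction_graph_iff hA hτ hN).2 ⟨_, _, rfl, rfl⟩⟩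
    let u : deficiencySpace τ Complex.I := ⟨G τ Complex.I ζ, G_mem_deficiencySpace hA hN hI ζ⟩
    refine ⟨incl A (φ + Q (ζ + W ζ)), mem_restriction_domain.2 ⟨_, ?_, rfl⟩, _, ⟨u, rfl⟩, ?_⟩
    · rw [map_add, h, ← (hQ _).2.2, neg_add_cancel]
    · have h1 := key (φ + Q (ζ + W ζ)) ζ (W ζ)
      rw [add_sub_cancel_right, ← hW ζ u rfl] at h1
      exact h1.symm

theorem exists_deficiencyEquiv (hA : IsSelfAdjoint A) (hτ : Function.Surjective τ)
    (hN : Dense ((restriction τ).domain : Set H)) {z : ℂ} (hz : z ∈ resolventSet A) :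
    ∃ e : 𝔥 ≃ₗ[ℂ] deficiencySpace τ z, ∀ ζ, (e ζ : H) = G τ z ζ := by
  refine ⟨LinearEquiv.ofBijective ((G τ z).toLinearMap.codRestrict (deficiencySpace τ z)
    (G_mem_deficiencySpace hA hN hz)) ⟨fun ζ η h => ?_, fun x => ?_⟩, fun _ => rfl⟩
  · exact G_injective hA hτ hN hz (congrArg Subtype.val h)
  · obtain ⟨ζ, hζ⟩ := (range_G hA hτ hN hz).ge x.2
    exact ⟨ζ, Subtype.ext hζ⟩

theorem norm_G_neg_I (hA : IsSelfAdjoint A) (ζ : 𝔥) :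
    ‖G τ (-Complex.I) ζ‖ = ‖G τ Complex.I ζ‖ := by
  have h := inner_G_neg_I (τ := τ) hA ζ ζ
  rw [inner_self_eq_norm_sq_to_K, inner_self_eq_norm_sq_to_K] at h
  norm_cast at h
  exact (pow_left_inj₀ (norm_nonneg _) (norm_nonneg _) two_ne_zero).1 h

/-- A bijection of `𝔥` preserving `⟨G_+ ·, G_+ ·⟩` defines a unitary `K_+ → K_-`. -/
theorem exists_unitary (hA : IsSelfAdjoint A) (hτ : Function.Surjective τ)
    (hN : Dense ((restriction τ).domain : Set H)) (W : 𝔥 ≃ₗ[ℂ] 𝔥)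
    (hW : ∀ ζ, ‖G τ Complex.I (W ζ)‖ = ‖G τ Complex.I ζ‖) :
    ∃ U : deficiencySpace τ Complex.I ≃ₗᵢ[ℂ] deficiencySpace τ (-Complex.I),
      ∀ (ζ : 𝔥) (u : deficiencySpace τ Complex.I), (u : H) = G τ Complex.I ζ →
        (U u : H) = -G τ (-Complex.I) (W ζ) := by
  obtain ⟨e, he⟩ := exists_deficiencyEquiv hA hτ hN (I_mem_resolventSet hA)
  obtain ⟨f, hf⟩ := exists_deficiencyEquiv hA hτ hN (neg_I_mem_resolventSet hA)
  refine ⟨⟨e.symm ≪≫ₗ W ≪≫ₗ f ≪≫ₗ LinearEquiv.neg ℂ, fun u => ?_⟩, fun ζ u hu => ?_⟩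
  · obtain ⟨ζ, rfl⟩ := e.surjective u
    have h1 := hf (W ζ)
    have h2 := he ζ
    simp only [LinearEquiv.trans_apply, LinearEquiv.symm_apply_apply, LinearEquiv.neg_apply,
      norm_neg]
    rw [Submodule.coe_norm, Submodule.coe_norm, h1, h2, norm_G_neg_I hA, hW]
  · obtain rfl : u = e ζ := Subtype.ext (hu.trans (he ζ).symm)
    change ((-(f (W (e.symm (e ζ)))) : deficiencySpace τ (-Complex.I)) : H) = _
    rw [LinearEquiv.symm_apply_apply, Submodule.coe_neg, hf]

/-- Every unitary `K_+ → K_-` is of the form `-G_- W G_+⁻¹`. -/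
theorem exists_equiv_of_unitary (hA : IsSelfAdjoint A) (hτ : Function.Surjective τ)
    (hN : Dense ((restriction τ).domain : Set H))
    (U : deficiencySpace τ Complex.I ≃ₗᵢ[ℂ] deficiencySpace τ (-Complex.I)) :
    ∃ W : 𝔥 ≃ₗ[ℂ] 𝔥, Continuous W ∧
      (∀ (ζ : 𝔥) (u : deficiencySpace τ Complex.I), (u : H) = G τ Complex.I ζ →
        (U u : H) = -G τ (-Complex.I) (W ζ)) ∧
      ∀ ζ η, ⟪G τ Complex.I (W ζ), G τ Complex.I (W η)⟫_ℂ =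
        ⟪G τ Complex.I ζ, G τ Complex.I η⟫_ℂ := by
  obtain ⟨e, he⟩ := exists_deficiencyEquiv hA hτ hN (I_mem_resolventSet hA)
  obtain ⟨f, hf⟩ := exists_deficiencyEquiv hA hτ hN (neg_I_mem_resolventSet hA)
  obtain ⟨L, hL, -⟩ := exists_left_inverse_G hA hτ hN (neg_I_mem_resolventSet hA)
  let W : 𝔥 ≃ₗ[ℂ] 𝔥 := e ≪≫ₗ U.toLinearEquiv ≪≫ₗ f.symm ≪≫ₗ LinearEquiv.neg ℂ
  have hW : ∀ ζ, (U (e ζ) : H) = -G τ (-Complex.I) (W ζ) := by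
    intro ζ
    have h1 : W ζ = -f.symm (U (e ζ)) := rfl
    rw [h1, map_neg, neg_neg, ← hf, LinearEquiv.apply_symm_apply]
  refine ⟨W, ?_, fun ζ u hu => ?_, fun ζ η => ?_⟩
  · have h1 : (W : 𝔥 → 𝔥) = fun ζ => -L (U (e ζ)) := by
      ext ζ
      rw [hW, map_neg, hL, neg_neg]
    have h2 : Continuous e := by
      refine continuous_induced_rng.2 ?_
      rw [show Subtype.val ∘ e = G τ Complex.I from funext he]
      exact (G τ Complex.I).continuous
    rw [h1]
    exact (L.continuous.comp (continuous_subtype_val.comp (U.continuous.comp h2))).neg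
  · obtain rfl : u = e ζ := Subtype.ext (hu.trans (he ζ).symm)
    exact hW ζ
  · rw [← inner_G_neg_I hA, ← inner_neg_neg, ← hW, ← hW, ← Submodule.coe_inner, U.inner_map_map,
      Submodule.coe_inner, he, he]

end ExtensionGraphs

/-! ### From `(Π, Θ)` to the unitary `U`. -/

section KreinToVonNeumann

variable {H : Type*} [NormedAddCommGroup H] [InnerProductSpace ℂ H] [CompleteSpace H]
variable {𝔥 : Type*} [NormedAddCommGroup 𝔥] [InnerProductSpace ℂ 𝔥] [CompleteSpace 𝔥]
variable {A : H →ₗ.[ℂ] H} {τ : GraphSpace A →L[ℂ] 𝔥}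

variable (τ) in
/-- The operator `Π Γ̂ : 𝔥 → 𝔥₀`. -/
def projGamma (h₀ : Submodule ℂ 𝔥) [CompleteSpace h₀] : 𝔥 →ₗ[ℂ] h₀ :=
  h₀.orthogonalProjectionOnto.toLinearMap ∘ₗ gammaHat τ Complex.I

theorem projGamma_coe (h₀ : Submodule ℂ 𝔥) [CompleteSpace h₀] (ζ : h₀) :
    projGamma τ h₀ (ζ : 𝔥) = compressedGamma τ h₀ Complex.I ζ := rfl

/-- By `⟨u, Γ̂ζ⟩ = i⟨G_+ u, G_+ ζ⟩` the complement `𝔥₀'` is the kernel of `ΠΓ̂`. Hence the direct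
sum follows from invertibility of `ΠΓ̂Π`, and `1 + 2(Θ - ΠΓ̂Π)⁻¹ΠΓ̂` is the identity on `𝔥₀'`. -/
theorem mem_deficiencyComplement (hA : IsSelfAdjoint A) {h₀ : Submodule ℂ 𝔥} [CompleteSpace h₀]
    {ζ : 𝔥} : ζ ∈ deficiencyComplement τ h₀ ↔
      projGamma τ h₀ ζ = 0 := by
  change _ ↔ h₀.orthogonalProjectionOnto (gammaHat τ Complex.I ζ) = 0
  rw [Submodule.orthogonalProjectionOnto_eq_zero_iff, Submodule.mem_orthogonal,
    deficiencyComplement, Submodule.mem_comap, Submodule.mem_orthogonal]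
  constructor
  · intro h u hu
    rw [inner_gammaHat hA]
    have h1 : ⟪G τ Complex.I u, G τ Complex.I ζ⟫_ℂ = 0 := h _ ⟨u, hu, rfl⟩
    rw [h1, mul_zero]
  · rintro h _ ⟨u, hu, rfl⟩
    have h1 := h u hu
    rw [inner_gammaHat hA] at h1
    exact (mul_eq_zero.1 h1).resolve_left Complex.I_ne_zero

theorem isCompl_deficiencyComplement (hA : IsSelfAdjoint A) (hτ : Function.Surjective τ)
    (hN : Dense ((restriction τ).domain : Set H)) (h₀ : Submodule ℂ 𝔥) [CompleteSpace h₀] :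
    IsCompl h₀ (deficiencyComplement τ h₀) := by
  obtain ⟨B, hB1, hB2⟩ := exists_inverse_compressedGamma hA hτ hN h₀
  rw [isCompl_iff, Submodule.disjoint_def, codisjoint_iff, Submodule.eq_top_iff']
  refine ⟨fun ζ hζ hζ' => ?_, fun ζ => ?_⟩
  · have h1 : projGamma τ h₀ ((⟨ζ, hζ⟩ : h₀) : 𝔥) = 0 := (mem_deficiencyComplement hA).1 hζ'
    have h2 := hB1 ⟨ζ, hζ⟩
    rw [← projGamma_coe, h1, map_zero] at h2
    exact (congrArg Subtype.val h2).symm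
  · obtain ⟨ξ, hξ⟩ : ∃ ξ : h₀, projGamma τ h₀ (ξ : 𝔥) = projGamma τ h₀ ζ :=
      ⟨B (projGamma τ h₀ ζ), by rw [projGamma_coe, hB2]⟩
    refine Submodule.mem_sup.2 ⟨ξ, ξ.2, ζ - ξ, (mem_deficiencyComplement hA).2 ?_,
      add_sub_cancel _ _⟩
    rw [map_sub, hξ, sub_self]

theorem deficiencyComplement_eq_orthogonal (hA : IsSelfAdjoint A) (hτ : Function.Surjective τ)
    (hN : Dense ((restriction τ).domain : Set H)) (h₀ : Submodule ℂ 𝔥) [CompleteSpace h₀]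
    (h : ∀ ζ : 𝔥, h₀.starProjection (gammaHat τ Complex.I ζ) =
      gammaHat τ Complex.I (h₀.starProjection ζ)) : deficiencyComplement τ h₀ = h₀ᗮ := by
  obtain ⟨B, hB, -⟩ := exists_inverse_gammaHat hA hτ hN
  ext ζ
  rw [mem_deficiencyComplement hA, ← Submodule.starProjection_apply_eq_zero_iff (K := h₀),
    ← Submodule.coe_eq_zero]
  change h₀.starProjection (gammaHat τ Complex.I ζ) = 0 ↔ _
  rw [h]
  refine ⟨fun h1 => ?_, fun h1 => by rw [h1, map_zero]⟩
  rw [← hB (h₀.starProjection ζ), h1, map_zero]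

theorem mem_thetaMinus_graph {h₀ : Submodule ℂ 𝔥} [CompleteSpace h₀] {Θ : h₀ →ₗ.[ℂ] h₀}
    {ξ v : h₀} : (ξ, v) ∈ (thetaMinus τ h₀ Θ).graph ↔ (ξ, v + projGamma τ h₀ ξ) ∈ Θ.graph := by
  rw [thetaMinus, mem_vadd_graph, LinearMap.neg_apply, sub_neg_eq_add, projGamma_coe]

theorem mem_gammaTheta_graph {h₀ : Submodule ℂ 𝔥} [CompleteSpace h₀] {Θ : h₀ →ₗ.[ℂ] h₀}
    {ξ v : h₀} : (ξ, v) ∈ (gammaTheta τ h₀ Θ Complex.I).graph ↔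
      (ξ, v - projGamma τ h₀ ξ) ∈ Θ.graph := by
  rw [gammaTheta, mem_vadd_graph, projGamma_coe]

/-- The bijection `W = 1 + 2 (Θ - Π Γ̂ Π)⁻¹ Π Γ̂` of `𝔥`. -/
theorem exists_equiv_of_theta (hA : IsSelfAdjoint A) (hτ : Function.Surjective τ)
    (hN : Dense ((restriction τ).domain : Set H)) {h₀ : Submodule ℂ 𝔥} [CompleteSpace h₀]
    {Θ : h₀ →ₗ.[ℂ] h₀} (hΘ : IsSelfAdjoint Θ) :
    ∃ W : 𝔥 ≃ₗ[ℂ] 𝔥,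
      (∀ ζ, W ζ = ζ + (2 : ℂ) •
        (boundedInverse (thetaMinus τ h₀ Θ) (projGamma τ h₀ ζ) : 𝔥)) ∧
      ∀ ζ, ‖G τ Complex.I (W ζ)‖ = ‖G τ Complex.I ζ‖ := by
  have hM := hasBoundedInverse_thetaMinus hA hτ hN h₀ hΘ
  have hP := (mem_zSet_of_im_ne_zero hA hτ hN h₀ hΘ (z := Complex.I) (by simp)).2
  let f : 𝔥 →ₗ[ℂ] 𝔥 := LinearMap.id + (2 : ℂ) •
    (h₀.subtype ∘ₗ (boundedInverse (thetaMinus τ h₀ Θ)).toLinearMap ∘ₗ projGamma τ h₀)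
  -- The inverse of `W` is `1 - 2(Θ + ΠΓ̂Π)⁻¹ΠΓ̂`: if `ω = ζ + 2ξ`, then `Θξ = ΠΓ̂(ζ + ξ)` is the
  -- same as `Θξ = ΠΓ̂(ω - ξ)`.
  let g : 𝔥 →ₗ[ℂ] 𝔥 := LinearMap.id - (2 : ℂ) •
    (h₀.subtype ∘ₗ (boundedInverse (gammaTheta τ h₀ Θ Complex.I)).toLinearMap ∘ₗ projGamma τ h₀)
  have hf : ∀ ζ, f ζ = ζ + (2 : ℂ) •
    (boundedInverse (thetaMinus τ h₀ Θ) (projGamma τ h₀ ζ) : 𝔥) := fun _ => rfl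
  have hg : ∀ ζ, g ζ = ζ - (2 : ℂ) •
    (boundedInverse (gammaTheta τ h₀ Θ Complex.I) (projGamma τ h₀ ζ) : 𝔥) := fun _ => rfl
  refine ⟨LinearEquiv.ofLinearMap f g (LinearMap.ext fun ω => ?_) (LinearMap.ext fun ζ => ?_), hf,
    fun ζ => ?_⟩
  · set ξ := boundedInverse (gammaTheta τ h₀ Θ Complex.I) (projGamma τ h₀ ω) with hξ
    have h1 := hP.mem_graph (projGamma τ h₀ ω)
    rw [← hξ, mem_gammaTheta_graph] at h1
    have h2 : boundedInverse (thetaMinus τ h₀ Θ) (projGamma τ h₀ (g ω)) = ξ := by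
      refine hM.apply_eq (mem_thetaMinus_graph.2 ?_)
      rw [hg, ← hξ, map_sub, map_smul]
      convert h1 using 2
      module
    rw [LinearMap.comp_apply, hf, h2, hg, ← hξ, sub_add_cancel]
    rfl
  · set ξ := boundedInverse (thetaMinus τ h₀ Θ) (projGamma τ h₀ ζ) with hξ
    have h1 := hM.mem_graph (projGamma τ h₀ ζ)
    rw [← hξ, mem_thetaMinus_graph] at h1
    have h2 : boundedInverse (gammaTheta τ h₀ Θ Complex.I) (projGamma τ h₀ (f ζ)) = ξ := by
      refine hP.apply_eq (mem_gammaTheta_graph.2 ?_)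
      rw [hf, ← hξ, map_add, map_smul]
      convert h1 using 2
      module
    rw [LinearMap.comp_apply, hg, h2, hf, ← hξ, add_sub_cancel_right]
    rfl
  · change ‖G τ Complex.I (f ζ)‖ = _
    set ξ := boundedInverse (thetaMinus τ h₀ Θ) (projGamma τ h₀ ζ) with hξ
    have h1 := hM.mem_graph (projGamma τ h₀ ζ)
    rw [← hξ, mem_thetaMinus_graph] at h1
    -- Symmetry of `Θ` at `ξ`, where `Θξ = ΠΓ̂(ζ + ξ)`, is exactly the vanishing of the cross terms
    -- in `⟨ζ + 2ξ, Γ̂(ζ + 2ξ)⟩ - ⟨ζ, Γ̂ζ⟩`.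
    have h2 := (mem_graph_of_isSelfAdjoint hΘ).1 h1 _ _ h1
    have h3 : ∀ η : 𝔥, ⟪ξ, projGamma τ h₀ η⟫_ℂ = ⟪(ξ : 𝔥), gammaHat τ Complex.I η⟫_ℂ := fun η =>
      Submodule.inner_orthogonalProjectionOnto_eq_of_mem_left ξ _
    have h4 : ∀ η : 𝔥, ⟪projGamma τ h₀ η, ξ⟫_ℂ = -⟪η, gammaHat τ Complex.I ξ⟫_ℂ := fun η => by
      rw [← inner_gammaHat_left hA]
      exact Submodule.inner_orthogonalProjectionOnto_eq_of_mem_right ξ _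
    rw [inner_add_left, inner_add_right, h3, h3, h4, h4] at h2
    have h5 : ⟪f ζ, gammaHat τ Complex.I (f ζ)⟫_ℂ = ⟪ζ, gammaHat τ Complex.I ζ⟫_ℂ := by
      rw [hf, ← hξ, map_add, map_smul]
      simp only [inner_add_left, inner_add_right, inner_smul_left, inner_smul_right, map_ofNat]
      linear_combination -2 * h2
    rw [inner_gammaHat hA, inner_gammaHat hA, inner_self_eq_norm_sq_to_K,
      inner_self_eq_norm_sq_to_K] at h5
    have h6 := mul_left_cancel₀ Complex.I_ne_zero h5
    norm_cast at h6
    exact (pow_left_inj₀ (norm_nonneg _) (norm_nonneg _) two_ne_zero).1 h6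

/-- The extension `A_U` with `U = -G_- W G_+⁻¹`, `W = 1 + 2 (Θ - Π Γ̂ Π)⁻¹ Π Γ̂`, is `A_{Π,Θ}`. -/
theorem vonNeumannExtension_eq_kreinExtension (hA : IsSelfAdjoint A) (hτ : Function.Surjective τ)
    (hN : Dense ((restriction τ).domain : Set H)) {h₀ : Submodule ℂ 𝔥} [CompleteSpace h₀]
    {Θ : h₀ →ₗ.[ℂ] h₀} (hΘ : IsSelfAdjoint Θ) {W : 𝔥 ≃ₗ[ℂ] 𝔥}
    (hWΘ : ∀ ζ, W ζ = ζ + (2 : ℂ) •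
        (boundedInverse (thetaMinus τ h₀ Θ) (projGamma τ h₀ ζ) : 𝔥))
    {U : deficiencySpace τ Complex.I ≃ₗᵢ[ℂ] deficiencySpace τ (-Complex.I)}
    (hU : ∀ (ζ : 𝔥) (u : deficiencySpace τ Complex.I), (u : H) = G τ Complex.I ζ →
      (U u : H) = -G τ (-Complex.I) (W ζ))
    {z : ℂ} (hz : z ∈ zSet τ h₀ Θ) :
    vonNeumannExtension τ U = kreinExtension τ h₀ Θ z := by
  have hM := hasBoundedInverse_thetaMinus hA hτ hN h₀ hΘ
  refine LinearPMap.eq_of_eq_graph ?_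
  rw [kreinExtension_graph hA hτ hN hz]
  ext ⟨x, y⟩
  rw [mem_kreinGraph_iff hA hz, mem_vonNeumannExtension_graph_iff hA hτ hN hU]
  constructor
  · rintro ⟨φ, ζ, h, rfl, rfl⟩
    set ξ := boundedInverse (thetaMinus τ h₀ Θ) (projGamma τ h₀ ζ) with hξ
    have h1 := hM.mem_graph (projGamma τ h₀ ζ)
    rw [← hξ, mem_thetaMinus_graph] at h1
    have h2 : ζ - W ζ = (((-2 : ℂ) • ξ : h₀) : 𝔥) := by
      rw [hWΘ, ← hξ, Submodule.coe_smul]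
      module
    have h3 : ζ + W ζ = (2 : ℂ) • (ζ + ξ) := by
      rw [hWΘ, ← hξ]
      module
    refine ⟨φ, (-2 : ℂ) • ξ, ?_, by rw [h2], by rw [h2]⟩
    convert Θ.graph.smul_mem (-2 : ℂ) h1 using 1
    refine Prod.ext rfl ?_
    change h₀.orthogonalProjectionOnto (τ φ) = (-2 : ℂ) • (projGamma τ h₀ ζ + projGamma τ h₀ ξ)
    rw [h, h3, map_neg, ← map_add, neg_smul, ← map_smul]
    rfl
  · rintro ⟨φ, η, h, rfl, rfl⟩
    obtain ⟨B, -, hB⟩ := exists_inverse_gammaHat hA hτ hN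
    have hφ : h₀.orthogonalProjectionOnto (τ φ) = projGamma τ h₀ (B (τ φ)) := by
      conv_lhs => rw [← hB (τ φ)]
      rfl
    -- Forced by the two requirements `ζ - Wζ = η` and `Γ̂(ζ + Wζ) = -τφ`, with `B = Γ̂⁻¹`.
    let ζ : 𝔥 := (1 / 2 : ℂ) • (η - B (τ φ))
    have h1 : boundedInverse (thetaMinus τ h₀ Θ) (projGamma τ h₀ ζ) = (-1 / 2 : ℂ) • η := by
      refine hM.apply_eq (mem_thetaMinus_graph.2 ?_)
      convert Θ.graph.smul_mem (-1 / 2 : ℂ) h using 1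
      refine Prod.ext rfl ?_
      change projGamma τ h₀ ((1 / 2 : ℂ) • (η - B (τ φ))) +
        projGamma τ h₀ (((-1 / 2 : ℂ) • η : h₀) : 𝔥) = (-1 / 2 : ℂ) • _
      rw [hφ, Submodule.coe_smul, map_smul, map_smul, map_sub]
      module
    have h2 : W ζ = ζ - η := by
      rw [hWΘ, h1, Submodule.coe_smul]
      module
    have h3 : ζ + W ζ = -B (τ φ) := by
      rw [h2]
      module
    refine ⟨φ, ζ, ?_, ?_, ?_⟩
    · rw [h3, map_neg, hB, neg_neg]
    · rw [h2, sub_sub_cancel]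
    · rw [h2, sub_sub_cancel]

end KreinToVonNeumann

/-! ### The projection `P` and the space `P*[R(P)]`. -/

section Projections

/-- For a bounded surjection `τ` and a closed subspace `M ⊇ Ker τ`, the space `τ[M^⊥]` is a closed
complement of `τ[M]`. -/
theorem exists_projection {K E : Type*} [NormedAddCommGroup K] [InnerProductSpace ℂ K]
    [CompleteSpace K] [NormedAddCommGroup E] [InnerProductSpace ℂ E] (τ : K →L[ℂ] E)
    (σ : E →L[ℂ] K) (hσ : ∀ x, τ (σ x) = x) (M : Submodule ℂ K) (hM : IsClosed (M : Set K))
    (hτM : LinearMap.ker τ.toLinearMap ≤ M) :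
    ∃ P : E →L[ℂ] E, P ∘L P = P ∧
      LinearMap.ker P.toLinearMap = (M ⊓ (LinearMap.ker τ.toLinearMap)ᗮ).map τ.toLinearMap ∧
      LinearMap.range P.toLinearMap = Mᗮ.map τ.toLinearMap ∧
      ∀ φ, P (τ φ) = 0 ↔ φ ∈ M := by
  have : CompleteSpace M := hM.completeSpace_coe
  have : CompleteSpace (LinearMap.ker τ.toLinearMap) :=
    (ContinuousLinearMap.isClosed_ker τ).completeSpace_coe
  -- `P` sends `τφ` to `τ` of the component of `φ` in `M^⊥`. This does not depend on the choice of
  -- `φ`, because `Ker τ ⊆ M`.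
  let P : E →L[ℂ] E := τ ∘L Mᗮ.starProjection ∘L σ
  have hP : ∀ φ, P (τ φ) = τ (Mᗮ.starProjection φ) := by
    intro φ
    have h1 : σ (τ φ) - φ ∈ M := hτM (by
      rw [LinearMap.mem_ker]
      change τ (σ (τ φ) - φ) = 0
      rw [map_sub, hσ, sub_self])
    have h2 : Mᗮ.starProjection (σ (τ φ) - φ) = 0 := by
      rw [Submodule.starProjection_apply_eq_zero_iff, Submodule.orthogonal_orthogonal]
      exact h1
    rw [map_sub, sub_eq_zero] at h2
    change τ (Mᗮ.starProjection (σ (τ φ))) = _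
    rw [h2]
  have hP0 : ∀ φ, P (τ φ) = 0 ↔ φ ∈ M := by
    intro φ
    have h3 : Mᗮ.starProjection φ = 0 ↔ φ ∈ M := by
      rw [Submodule.starProjection_apply_eq_zero_iff, Submodule.orthogonal_orthogonal]
    rw [hP, ← h3]
    refine ⟨fun h => ?_, fun h => by rw [h, map_zero]⟩
    have h4 : Mᗮ.starProjection φ ∈ M ⊓ Mᗮ := ⟨hτM h, Submodule.starProjection_apply_mem _ _⟩
    rwa [Submodule.inf_orthogonal_eq_bot, Submodule.mem_bot] at h4
  refine ⟨P, ?_, ?_, ?_, hP0⟩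
  · ext x
    rw [← hσ x, ContinuousLinearMap.comp_apply, hP, hP]
    congr 1
    exact Submodule.starProjection_eq_self_iff.2 (Submodule.starProjection_apply_mem _ _)
  · ext x
    constructor
    · intro hx
      rw [← hσ x] at hx
      have h1 := (hP0 _).1 hx
      have h2 := Submodule.sub_starProjection_mem_orthogonal (K := LinearMap.ker τ.toLinearMap) (σ x)
      have h3 := Submodule.starProjection_apply_mem (LinearMap.ker τ.toLinearMap) (σ x)
      refine ⟨_, ⟨M.sub_mem h1 (hτM h3), h2⟩, ?_⟩
      change τ (σ x - _) = x
      rw [map_sub, hσ]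
      exact (congrArg (x - ·) h3).trans (sub_zero x)
    · rintro ⟨φ, ⟨hφ, -⟩, rfl⟩
      exact (hP0 φ).2 hφ
  · ext x
    constructor
    · rintro ⟨y, rfl⟩
      exact ⟨_, Submodule.starProjection_apply_mem _ (σ y), rfl⟩
    · rintro ⟨φ, hφ, rfl⟩
      refine ⟨τ φ, ?_⟩
      change P (τ φ) = τ φ
      rw [hP, Submodule.starProjection_eq_self_iff.2 hφ]

/-- The adjoint of a bounded projection `P` maps the range of `P` onto `Ker(P)^⊥`. -/
theorem map_adjoint_range {E : Type*} [NormedAddCommGroup E] [InnerProductSpace ℂ E]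
    [CompleteSpace E] {P : E →L[ℂ] E} (hP : P ∘L P = P) :
    (LinearMap.range P.toLinearMap).map (ContinuousLinearMap.adjoint P).toLinearMap =
      (LinearMap.ker P.toLinearMap)ᗮ := by
  have hPP : ∀ x, P (P x) = P x := fun x => DFunLike.congr_fun hP x
  ext y
  constructor
  · rintro ⟨x, -, rfl⟩
    rw [Submodule.mem_orthogonal']
    intro u hu
    change ⟪ContinuousLinearMap.adjoint P x, u⟫_ℂ = 0
    rw [ContinuousLinearMap.adjoint_inner_left, show P u = 0 from hu, inner_zero_right]
  · intro hy
    rw [Submodule.mem_orthogonal'] at hy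
    -- Elements of `Ker(P)^⊥` are fixed by `P*`. As `P*` annihilates `R(P)^⊥`, replacing `y` by its
    -- orthogonal projection onto `R(P)` does not change its image under `P*`.
    have h1 : ContinuousLinearMap.adjoint P y = y := by
      refine ext_inner_right ℂ fun x => ?_
      have h2 := hy (x - P x) (by
        rw [LinearMap.mem_ker]
        change P (x - P x) = 0
        rw [map_sub, hPP, sub_self])
      rw [inner_sub_right, sub_eq_zero] at h2
      rw [ContinuousLinearMap.adjoint_inner_left, h2]
    have hr : IsClosed (LinearMap.range P.toLinearMap : Set E) := by
      have : (LinearMap.range P.toLinearMap : Set E) = {x | P x = x} := by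
        ext x
        constructor
        · rintro ⟨u, rfl⟩
          exact hPP u
        · intro h
          exact ⟨x, h⟩
      rw [this]
      exact isClosed_eq P.continuous continuous_id
    have : CompleteSpace (LinearMap.range P.toLinearMap) := hr.completeSpace_coe
    refine ⟨(LinearMap.range P.toLinearMap).starProjection y,
      Submodule.starProjection_apply_mem _ _, ?_⟩
    change ContinuousLinearMap.adjoint P _ = y
    rw [← sub_eq_zero, ← neg_eq_zero, neg_sub]
    nth_rewrite 1 [← h1]
    rw [← map_sub]
    refine ext_inner_right ℂ fun x => ?_
    rw [ContinuousLinearMap.adjoint_inner_left, inner_zero_left]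
    exact Submodule.starProjection_inner_eq_zero y _ ⟨x, rfl⟩

end Projections

/-! ### The compressed inverse Cayley transform. -/

section CayleyTransform

variable {E : Type*} [NormedAddCommGroup E] [InnerProductSpace ℂ E] [CompleteSpace E]

/-- Let `W` be a bijection preserving a nondegenerate skew form `⟨·, Γ ·⟩`. The inverse Cayley
transform of `W`, compressed to the orthogonal complement of the image under `Γ` of the fixed
points of `W`, is self-adjoint. -/
theorem exists_isSelfAdjoint_inverse_cayley (Γ : E →ₗ[ℂ] E) (B : E → E) (hB : ∀ x, Γ (B x) = x)
    (hΓ : ∀ x y, ⟪Γ x, y⟫_ℂ = -⟪x, Γ y⟫_ℂ) (W : E ≃ₗ[ℂ] E)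
    (hW : ∀ x y, ⟪W x, Γ (W y)⟫_ℂ = ⟪x, Γ y⟫_ℂ) (m : Submodule ℂ E)
    (hm : ∀ x, x ∈ m ↔ W (B x) = B x) :
    ∃ Θ : mᗮ →ₗ.[ℂ] mᗮ, IsSelfAdjoint Θ ∧ ∀ ζ η : mᗮ, (ζ, η) ∈ Θ.graph ↔
      ∃ x, (ζ : E) = x - W x ∧ η = -mᗮ.orthogonalProjectionOnto (Γ (x + W x)) := by
  -- Nondegeneracy of the form, from surjectivity of `Γ`. Linear identities for `W` are checked
  -- below by pairing with all `Γ z`.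
  have hnd : ∀ {x y : E}, (∀ z, ⟪x, Γ z⟫_ℂ = ⟪y, Γ z⟫_ℂ) → x = y := by
    intro x y h
    refine ext_inner_right ℂ fun z => ?_
    rw [← hB z]
    exact h _
  have hBΓ : ∀ x, B (Γ x) = x := by
    intro x
    refine hnd fun z => ?_
    rw [← neg_inj, ← hΓ, ← hΓ, hB]
  have hmem : ∀ x, x - W x ∈ mᗮ := by
    intro x
    rw [Submodule.mem_orthogonal]
    intro u hu
    have h1 := (hm u).1 hu
    have h2 := hW (B u) x
    rw [h1] at h2
    rw [← hB u, hΓ, map_sub, inner_sub_right, h2, sub_self, neg_zero]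
  let F : E →ₗ[ℂ] mᗮ × mᗮ :=
    ((LinearMap.id - W.toLinearMap).codRestrict mᗮ hmem).prod
      (-(mᗮ.orthogonalProjectionOnto.toLinearMap ∘ₗ Γ ∘ₗ (LinearMap.id + W.toLinearMap)))
  have hF1 : ∀ x, ((F x).1 : E) = x - W x := fun _ => rfl
  have hF2 : ∀ x, (F x).2 = -mᗮ.orthogonalProjectionOnto (Γ (x + W x)) := fun _ => rfl
  have hg : ∀ ζ η : mᗮ, (ζ, η) ∈ (LinearMap.range F).toLinearPMap.graph ↔
      ∃ x, (ζ : E) = x - W x ∧ η = -mᗮ.orthogonalProjectionOnto (Γ (x + W x)) := by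
    intro ζ η
    rw [Submodule.toLinearPMap_graph_eq]
    · constructor
      · rintro ⟨x, hx⟩
        exact ⟨x, by rw [← hF1, hx], by rw [← hF2, hx]⟩
      · rintro ⟨x, h1, h2⟩
        exact ⟨x, Prod.ext (Subtype.ext (by rw [h1, hF1])) (by rw [h2, hF2])⟩
    -- Single valuedness: if `Wx = x`, then `Γ(x + Wx)` lies in `m` and is removed by the projection
    -- onto `m^⊥`. Without the compression the relation could be multivalued.
    · rintro _ ⟨x, rfl⟩ h
      have h1 := congrArg Subtype.val h
      rw [hF1, Submodule.coe_zero, sub_eq_zero] at h1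
      rw [hF2, ← h1, neg_eq_zero, Submodule.orthogonalProjectionOnto_eq_zero_iff]
      refine Submodule.le_orthogonal_orthogonal m ?_
      rw [hm, hBΓ, map_add, ← h1]
  refine ⟨(LinearMap.range F).toLinearPMap, isSelfAdjoint_of_graph ?_ fun y v => ?_, hg⟩
  · rw [Submodule.dense_iff_topologicalClosure_eq_top, Submodule.topologicalClosure_eq_top_iff,
      Submodule.eq_bot_iff]
    intro y hy
    rw [Submodule.mem_orthogonal'] at hy
    have h1 : ∀ x, ⟪(y : E), x - W x⟫_ℂ = 0 := fun x =>
      hy _ (LinearPMap.mem_domain_of_mem_graph ((hg ⟨_, hmem x⟩ _).2 ⟨x, rfl, rfl⟩))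
    -- Orthogonality of `y` to the range of `1 - W` says that `By` is fixed by `W`; so `y ∈ m ∩
    -- m^⊥`, and the domain is dense.
    have h2 : W (B y) = B y := by
      have h3 : B y = W.symm (B y) := by
        refine hnd fun z => ?_
        rw [← hW (W.symm (B y)), LinearEquiv.apply_symm_apply]
        have h4 := h1 z
        rwa [← hB y, hΓ, neg_eq_zero, map_sub, inner_sub_right, sub_eq_zero] at h4
      nth_rewrite 1 [h3]
      exact W.apply_symm_apply _
    have h5 : (y : E) ∈ m ⊓ mᗮ := ⟨(hm _).2 h2, y.2⟩
    rw [Submodule.inf_orthogonal_eq_bot, Submodule.mem_bot] at h5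
    exact Subtype.ext h5
  · constructor
    · intro h x w hx
      rw [hg] at h hx
      obtain ⟨a, ha1, rfl⟩ := h
      obtain ⟨b, hb1, rfl⟩ := hx
      rw [inner_neg_left, inner_neg_right, Submodule.inner_orthogonalProjectionOnto_eq_of_mem_left,
        Submodule.inner_orthogonalProjectionOnto_eq_of_mem_right, hΓ, ha1, hb1]
      have h1 := hW a b
      simp only [map_add, map_sub, inner_add_left, inner_sub_left, inner_add_right,
        inner_sub_right]
      linear_combination -2 * h1
    · intro h
      rw [hg]
      -- Solving `x - Wx = y` and `-Γ(x + Wx) = v` gives `x = (y - Bv)/2` and `Wx = -(y + Bv)/2`.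
      -- The adjoint relation for `(y, v)` is precisely this compatibility with `W`.
      have h1 : W (B v - y) = B v + y := by
        have h2 : B v - y = W.symm (B v + y) := by
          refine hnd fun z => ?_
          rw [← hW (W.symm (B v + y)), LinearEquiv.apply_symm_apply]
          have h3 := h ⟨_, hmem z⟩ _ ((hg _ _).2 ⟨z, rfl, rfl⟩)
          rw [inner_neg_right, Submodule.inner_orthogonalProjectionOnto_eq_of_mem_left,
            Submodule.coe_inner] at h3
          have h4 := hΓ (B v) (z - W z)
          rw [hB] at h4
          rw [h4] at h3
          simp only [map_add, map_sub, inner_add_left, inner_sub_left, inner_add_right,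
            inner_sub_right] at h3 ⊢
          linear_combination -h3
        rw [h2, LinearEquiv.apply_symm_apply]
      have h5 : W ((-1 / 2 : ℂ) • (B v - y)) = (-1 / 2 : ℂ) • (B v + y) := by
        rw [map_smul, h1]
      refine ⟨(-1 / 2 : ℂ) • (B v - y), ?_, ?_⟩
      · rw [h5]
        module
      · have h6 : (-1 / 2 : ℂ) • (B v - y) + (-1 / 2 : ℂ) • (B v + y) = -B v := by module
        rw [h5, h6, map_neg, hB, map_neg, neg_neg,
          Submodule.orthogonalProjectionOnto_mem_subspace_eq_self]

end CayleyTransform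

/-! ### From the unitary `U` to `(Π, Θ)`. -/

section VonNeumannToKrein

variable {H : Type*} [NormedAddCommGroup H] [InnerProductSpace ℂ H] [CompleteSpace H]
variable {𝔥 : Type*} [NormedAddCommGroup 𝔥] [InnerProductSpace ℂ 𝔥] [CompleteSpace 𝔥]
variable {A : H →ₗ.[ℂ] H} {τ : GraphSpace A →L[ℂ] 𝔥}

/-- The Cayley transform of `A` maps `G_+ ζ` to `G_- ζ`. -/
theorem cayley_G_I (hA : IsSelfAdjoint A) (ζ : 𝔥) :
    cayley A (G τ Complex.I ζ) = G τ (-Complex.I) ζ := by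
  obtain ⟨Q, hQ⟩ := exists_lift_Gstar_sub_G (τ := τ) hA (I_mem_resolventSet hA)
  obtain ⟨h1, h2, -⟩ := hQ ζ
  have h3 := resolvent_smul_sub (neg_I_mem_resolventSet hA) (Q ζ)
  have h4 : -Complex.I • incl A (Q ζ) - op A (Q ζ) = Complex.I • G τ Complex.I ζ := by
    rw [h1, h2, Gstar_apply, adjGstar_apply]
    module
  rw [h4, map_smul] at h3
  have h5 : Complex.I • cayley A (G τ Complex.I ζ) = Complex.I • G τ (-Complex.I) ζ := by
    rw [← map_smul]
    change -op A (resolvent A (-Complex.I) (Complex.I • G τ Complex.I ζ)) +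
      Complex.I • incl A (resolvent A (-Complex.I) (Complex.I • G τ Complex.I ζ)) = _
    rw [map_smul, h3, h1, h2, Gstar_apply, adjGstar_apply]
    module
  exact smul_right_injective H Complex.I_ne_zero h5

theorem adjoint_G_neg_I (hA : IsSelfAdjoint A) (ζ : 𝔥) :
    ContinuousLinearMap.adjoint (G τ (-Complex.I)) (G τ (-Complex.I) ζ) =
      -Complex.I • gammaHat τ Complex.I ζ := by
  refine ext_inner_left ℂ fun η => ?_
  rw [ContinuousLinearMap.adjoint_inner_right, inner_G_neg_I hA, inner_smul_right,
    inner_gammaHat hA, ← mul_assoc, neg_mul, Complex.I_mul_I, neg_neg, one_mul]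

/-- By uniqueness of boundary values, `φ ∈ D(A)` lies in `D(A_U)` iff `ζ - Wζ = 0` for some `ζ` with
`τφ = -Γ̂(ζ + Wζ) = -2Γ̂ζ`. So `τ[M]` is the image under `Γ̂` of the fixed points of `W`. -/
theorem mem_commonDomain_iff (hA : IsSelfAdjoint A) (hτ : Function.Surjective τ)
    (hN : Dense ((restriction τ).domain : Set H))
    {U : deficiencySpace τ Complex.I ≃ₗᵢ[ℂ] deficiencySpace τ (-Complex.I)} {W : 𝔥 ≃ₗ[ℂ] 𝔥}
    (hU : ∀ (ζ : 𝔥) (u : deficiencySpace τ Complex.I), (u : H) = G τ Complex.I ζ →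
      (U u : H) = -G τ (-Complex.I) (W ζ))
    {B : 𝔥 →L[ℂ] 𝔥} (hB1 : ∀ ζ, B (gammaHat τ Complex.I ζ) = ζ)
    (hB2 : ∀ ζ, gammaHat τ Complex.I (B ζ) = ζ) {φ : GraphSpace A} :
    φ ∈ commonDomain τ U ↔ W (B (τ φ)) = B (τ φ) := by
  rw [commonDomain, Submodule.mem_comap, LinearPMap.mem_domain_iff]
  simp only [mem_vonNeumannExtension_graph_iff hA hτ hN hU]
  constructor
  · rintro ⟨y, ψ, ζ, h1, h2, -⟩
    obtain ⟨rfl, h3⟩ := incl_add_Gstar_injective hA hτ hN (φ := φ) (ψ := ψ) (ζ := 0)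
      (η := ζ - W ζ)
      (by rw [map_zero, add_zero, h2])
    have h4 : W ζ = ζ := (sub_eq_zero.1 h3.symm).symm
    rw [h1, map_neg, hB1, h4, map_neg, map_add, h4]
  · intro h
    refine ⟨op A φ, φ, (-1 / 2 : ℂ) • B (τ φ), ?_, ?_, ?_⟩
    · have h1 : (-1 / 2 : ℂ) • B (τ φ) + (-1 / 2 : ℂ) • B (τ φ) = -B (τ φ) := by module
      rw [map_smul, h, h1, map_neg, hB2, neg_neg]
    · rw [map_smul W, h, sub_self, map_zero, add_zero]
    · rw [map_smul W, h, sub_self, map_zero, add_zero]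

theorem kreinExtension_eq_vonNeumannExtension (hA : IsSelfAdjoint A)
    (hτ : Function.Surjective τ) (hN : Dense ((restriction τ).domain : Set H))
    {U : deficiencySpace τ Complex.I ≃ₗᵢ[ℂ] deficiencySpace τ (-Complex.I)} {W : 𝔥 ≃ₗ[ℂ] 𝔥}
    (hU : ∀ (ζ : 𝔥) (u : deficiencySpace τ Complex.I), (u : H) = G τ Complex.I ζ →
      (U u : H) = -G τ (-Complex.I) (W ζ))
    (hW : ∀ ζ η, ⟪G τ Complex.I (W ζ), G τ Complex.I (W η)⟫_ℂ =
      ⟪G τ Complex.I ζ, G τ Complex.I η⟫_ℂ)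
    {B : 𝔥 →L[ℂ] 𝔥} (hB : ∀ ζ, gammaHat τ Complex.I (B ζ) = ζ) {m : Submodule ℂ 𝔥}
    [CompleteSpace m] (hm : ∀ x, x ∈ m ↔ W (B x) = B x) {Θ : mᗮ →ₗ.[ℂ] mᗮ}
    (hΘ : ∀ ζ η : mᗮ, (ζ, η) ∈ Θ.graph ↔ ∃ x, (ζ : 𝔥) = x - W x ∧
      η = -mᗮ.orthogonalProjectionOnto (gammaHat τ Complex.I (x + W x)))
    {z : ℂ} (hz : z ∈ zSet τ mᗮ Θ) :
    kreinExtension τ mᗮ Θ z = vonNeumannExtension τ U := by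
  have hsub : ∀ x, x - W x ∈ mᗮ := by
    intro x
    rw [Submodule.mem_orthogonal]
    intro u hu
    have h1 := (hm u).1 hu
    have h2 := hW (B u) x
    rw [h1] at h2
    rw [← hB u, inner_gammaHat_left hA, inner_gammaHat hA, map_sub, inner_sub_right, h2, sub_self,
      mul_zero, neg_zero]
  refine LinearPMap.eq_of_eq_graph ?_
  rw [kreinExtension_graph hA hτ hN hz]
  ext ⟨x, y⟩
  rw [mem_kreinGraph_iff hA hz, mem_vonNeumannExtension_graph_iff hA hτ hN hU]
  constructor
  · rintro ⟨φ, η, h, rfl, rfl⟩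
    obtain ⟨ζ, h1, h2⟩ := (hΘ _ _).1 h
    -- `Θ` controls `τφ` only modulo `m`. The defect `u` is absorbed by subtracting `Bu/2` from `ζ`:
    -- this is a fixed point of `W`, so `ζ - Wζ` is unchanged while `Γ̂(ζ + Wζ)` decreases by `u`.
    have h3 : τ φ + gammaHat τ Complex.I (ζ + W ζ) ∈ m := by
      rw [← m.orthogonal_orthogonal, ← Submodule.orthogonalProjectionOnto_eq_zero_iff, map_add, h2,
        neg_add_cancel]
    set u := τ φ + gammaHat τ Complex.I (ζ + W ζ) with hu
    have h4 := (hm u).1 h3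
    have h5 : W (ζ - (1 / 2 : ℂ) • B u) = W ζ - (1 / 2 : ℂ) • B u := by
      rw [map_sub, map_smul, h4]
    refine ⟨φ, ζ - (1 / 2 : ℂ) • B u, ?_, ?_, ?_⟩
    · have h6 : ζ - (1 / 2 : ℂ) • B u + (W ζ - (1 / 2 : ℂ) • B u) = ζ + W ζ - B u := by module
      rw [h5, h6, map_sub, hB, hu]
      abel
    · rw [h5, h1, sub_sub_sub_cancel_right]
    · rw [h5, h1, sub_sub_sub_cancel_right]
  · rintro ⟨φ, ζ, h, rfl, rfl⟩
    exact ⟨φ, ⟨_, hsub ζ⟩, (hΘ _ _).2 ⟨ζ, rfl, by rw [h, map_neg]⟩, rfl, rfl⟩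

end VonNeumannToKrein

end KreinVonNeumann

end

/-! ### The theorem. -/

open KreinVonNeumann in
theorem theorem3p1 {H : Type*} [NormedAddCommGroup H] [InnerProductSpace ℂ H] [CompleteSpace H]
    {𝔥 : Type*} [NormedAddCommGroup 𝔥] [InnerProductSpace ℂ 𝔥] [CompleteSpace 𝔥]
    (A : H →ₗ.[ℂ] H) (hA : IsSelfAdjoint A)
    (τ : GraphSpace A →L[ℂ] 𝔥) (hτ : Function.Surjective τ)
    (hN : Dense ((restriction τ).domain : Set H)) :
    -- Part 1
    ((Function.Injective (G τ Complex.I) ∧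
        LinearMap.range (G τ Complex.I).toLinearMap = deficiencySpace τ Complex.I) ∧
      (Function.Injective (G τ (-Complex.I)) ∧
        LinearMap.range (G τ (-Complex.I)).toLinearMap = deficiencySpace τ (-Complex.I)) ∧
      ∀ (h₀ : Submodule ℂ 𝔥) [CompleteSpace h₀] (Θ : h₀ →ₗ.[ℂ] h₀), IsSelfAdjoint Θ →
        {z : ℂ | z.im ≠ 0} ⊆ zSet τ h₀ Θ ∧
        HasBoundedInverse (thetaMinus τ h₀ Θ) ∧
        IsCompl h₀ (deficiencyComplement τ h₀) ∧
        ((∀ ζ : 𝔥, h₀.starProjection (gammaHat τ Complex.I ζ) =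
            gammaHat τ Complex.I (h₀.starProjection ζ)) → deficiencyComplement τ h₀ = h₀ᗮ) ∧
        ∃ U : deficiencySpace τ Complex.I ≃ₗᵢ[ℂ] deficiencySpace τ (-Complex.I),
          (∀ (ζ₀ : h₀) (ζ₁ : 𝔥), ζ₁ ∈ deficiencyComplement τ h₀ →
            ∀ x : deficiencySpace τ Complex.I, (x : H) = G τ Complex.I (ζ₀ + ζ₁) →
              (U x : H) = -G τ (-Complex.I)
                ((ζ₀ + (2 : ℂ) • boundedInverse (thetaMinus τ h₀ Θ)
                  (compressedGamma τ h₀ Complex.I ζ₀) : h₀) + ζ₁)) ∧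
          ((∃ C : ℝ, ∀ ζ : Θ.domain, ‖Θ ζ‖ ≤ C * ‖ζ‖) →
            Θ.domain = ⊤ ∧
            ∀ (ζ₀ : Θ.domain) (ζ₁ : 𝔥), ζ₁ ∈ deficiencyComplement τ h₀ →
              ∀ x : deficiencySpace τ Complex.I, (x : H) = G τ Complex.I ((ζ₀ : h₀) + ζ₁) →
                (U x : H) = -G τ (-Complex.I)
                  ((boundedInverse (thetaMinus τ h₀ Θ)
                    (Θ ζ₀ + compressedGamma τ h₀ Complex.I ζ₀) : h₀) + ζ₁)) ∧
          ∀ z ∈ zSet τ h₀ Θ,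
            (kreinExtension τ h₀ Θ z).graph = kreinGraph τ h₀ Θ z ∧
            IsSelfAdjoint (kreinExtension τ h₀ Θ z) ∧
            vonNeumannExtension τ U = kreinExtension τ h₀ Θ z) ∧
    -- Part 2
    (∀ U : deficiencySpace τ Complex.I ≃ₗᵢ[ℂ] deficiencySpace τ (-Complex.I),
      IsClosed (commonDomain τ U : Set (GraphSpace A)) ∧
      ∃ P : 𝔥 →L[ℂ] 𝔥, P ∘L P = P ∧
        LinearMap.ker P.toLinearMap =
          (commonDomain τ U ⊓ (LinearMap.ker τ.toLinearMap)ᗮ).map τ.toLinearMap ∧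
        LinearMap.range P.toLinearMap = ((commonDomain τ U)ᗮ).map τ.toLinearMap ∧
        ∃ (h₀ : Submodule ℂ 𝔥) (_ : CompleteSpace h₀) (Θ : h₀ →ₗ.[ℂ] h₀),
          h₀ = (((commonDomain τ U)ᗮ).map τ.toLinearMap).map
            (ContinuousLinearMap.adjoint P).toLinearMap ∧
          h₀ ≤ ((commonDomain τ U ⊓ (LinearMap.ker τ.toLinearMap)ᗮ).map τ.toLinearMap)ᗮ ∧
          (∀ ζ η : h₀, (ζ, η) ∈ Θ.graph ↔
            ∃ x : deficiencySpace τ Complex.I,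
              (U x : H) + cayley A x = G τ (-Complex.I) ζ ∧
              η = Complex.I • h₀.orthogonalProjectionOnto
                (ContinuousLinearMap.adjoint (G τ (-Complex.I)) ((U x : H) - cayley A x))) ∧
          IsSelfAdjoint Θ ∧
          {z : ℂ | z.im ≠ 0} ⊆ zSet τ h₀ Θ ∧
          ∀ z ∈ zSet τ h₀ Θ, kreinExtension τ h₀ Θ z = vonNeumannExtension τ U) := by
  have hI := I_mem_resolventSet hA
  have hI' := neg_I_mem_resolventSet hA
  refine ⟨⟨⟨G_injective hA hτ hN hI, range_G hA hτ hN hI⟩,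
    ⟨G_injective hA hτ hN hI', range_G hA hτ hN hI'⟩, ?_⟩, ?_⟩
  · intro h₀ _ Θ hΘ
    have hM := hasBoundedInverse_thetaMinus hA hτ hN h₀ hΘ
    refine ⟨fun z hz => mem_zSet_of_im_ne_zero hA hτ hN h₀ hΘ hz, hM,
      isCompl_deficiencyComplement hA hτ hN h₀,
      deficiencyComplement_eq_orthogonal hA hτ hN h₀, ?_⟩
    obtain ⟨W, hWΘ, hW⟩ := exists_equiv_of_theta hA hτ hN hΘ
    obtain ⟨U, hU⟩ := exists_unitary hA hτ hN W hW
    have hUdec : ∀ (ζ₀ : h₀) (ζ₁ : 𝔥), ζ₁ ∈ deficiencyComplement τ h₀ →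
        ∀ x : deficiencySpace τ Complex.I, (x : H) = G τ Complex.I (ζ₀ + ζ₁) →
          (U x : H) = -G τ (-Complex.I)
            ((ζ₀ + (2 : ℂ) • boundedInverse (thetaMinus τ h₀ Θ)
              (compressedGamma τ h₀ Complex.I ζ₀) : h₀) + ζ₁) := by
      intro ζ₀ ζ₁ h₁ x hx
      rw [hU _ x hx, hWΘ, map_add (projGamma τ h₀), (mem_deficiencyComplement hA).1 h₁, add_zero,
        projGamma_coe, Submodule.coe_add, Submodule.coe_smul, add_right_comm]
    refine ⟨U, hUdec, ?_, fun z hz => ⟨kreinExtension_graph hA hτ hN hz,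
      isSelfAdjoint_kreinExtension hA hτ hN hΘ hz,
      vonNeumannExtension_eq_kreinExtension hA hτ hN hΘ hWΘ hU hz⟩⟩
    rintro ⟨C, hC⟩
    refine ⟨domain_eq_top_of_bounded hΘ hC, fun ζ₀ ζ₁ h₁ x hx => ?_⟩
    rw [hUdec ζ₀ ζ₁ h₁ x hx]
    -- With `T = Θ - ΠΓ̂Π`, writing `ζ₀ = T⁻¹(Θ - ΠΓ̂Π)ζ₀` gives `ζ₀ + 2T⁻¹ΠΓ̂ζ₀ = T⁻¹(Θ + ΠΓ̂Π)ζ₀`.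
    have h2 : (ζ₀ : h₀) = boundedInverse (thetaMinus τ h₀ Θ)
        (Θ ζ₀ - compressedGamma τ h₀ Complex.I ζ₀) := by
      refine (hM.apply_eq (mem_thetaMinus_graph.2 ?_)).symm
      rw [projGamma_coe, sub_add_cancel]
      exact Θ.mem_graph ζ₀
    have h3 : (ζ₀ : h₀) + (2 : ℂ) • boundedInverse (thetaMinus τ h₀ Θ)
        (compressedGamma τ h₀ Complex.I ζ₀) = boundedInverse (thetaMinus τ h₀ Θ)
          (Θ ζ₀ + compressedGamma τ h₀ Complex.I ζ₀) := by
      nth_rewrite 1 [h2]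
      rw [← map_smul, ← map_add]
      congr 1
      module
    rw [h3]
  · intro U
    have hK : CompleteSpace (GraphSpace A) := GraphSpace.completeSpace hA.isClosed
    obtain ⟨W, hWc, hU, hW⟩ := exists_equiv_of_unitary hA hτ hN U
    obtain ⟨B, hB1, hB2⟩ := exists_inverse_gammaHat hA hτ hN
    obtain ⟨σ, hσ⟩ := exists_right_inverse hA hτ
    have hmem : ∀ φ, φ ∈ commonDomain τ U ↔ W (B (τ φ)) = B (τ φ) := fun φ =>
      mem_commonDomain_iff hA hτ hN hU hB1 hB2
    have hclosed : IsClosed (commonDomain τ U : Set (GraphSpace A)) := by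
      rw [show (commonDomain τ U : Set (GraphSpace A)) = {φ | W (B (τ φ)) = B (τ φ)} from
        Set.ext hmem]
      exact isClosed_eq (hWc.comp (B ∘L τ).continuous) (B ∘L τ).continuous
    refine ⟨hclosed, ?_⟩
    have hker : LinearMap.ker τ.toLinearMap ≤ commonDomain τ U := by
      intro n hn
      rw [hmem, show τ n = 0 from hn, map_zero, map_zero]
    obtain ⟨P, hPP, hPker, hPran, hP0⟩ := exists_projection τ σ hσ _ hclosed hker
    -- `Ker(P) = τ[M]` plays the role of `m`.
    have hm : ∀ x, x ∈ LinearMap.ker P.toLinearMap ↔ W (B x) = B x := by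
      intro x
      obtain ⟨φ, rfl⟩ := hτ x
      rw [← hmem, ← hP0]
      rfl
    have : CompleteSpace (LinearMap.ker P.toLinearMap) :=
      (ContinuousLinearMap.isClosed_ker P).completeSpace_coe
    obtain ⟨Θ, hΘ, hΘg⟩ := exists_isSelfAdjoint_inverse_cayley (gammaHat τ Complex.I) B hB2
      (inner_gammaHat_left hA) W
      (fun x y => by rw [inner_gammaHat hA, inner_gammaHat hA, hW]) _ hm
    refine ⟨P, hPP, hPker, hPran, (LinearMap.ker P.toLinearMap)ᗮ, inferInstance, Θ, ?_, ?_, ?_, hΘ,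
      fun z hz => mem_zSet_of_im_ne_zero hA hτ hN _ hΘ hz,
      fun z hz => kreinExtension_eq_vonNeumannExtension hA hτ hN hU hW hB2 hm hΘg hz⟩
    · rw [← hPran, map_adjoint_range hPP]
    · rw [← hPker]
    · intro ζ η
      -- Since `U_A G_+ = G_-`, the operators `U ± U_A` applied to `G_+ x` give `G_-(x - Wx)` and
      -- `-G_-(x + Wx)` respectively; with `G_-* G_- = -iΓ̂` the formula for `Θ` becomes the inverse
      -- Cayley transform of `W`.
      have h1 : ∀ x (u : deficiencySpace τ Complex.I), (u : H) = G τ Complex.I x →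
          (U u : H) + cayley A u = G τ (-Complex.I) (x - W x) := by
        intro x u hu
        rw [hU x u hu, hu, cayley_G_I hA, map_sub]
        abel
      have h2 : ∀ x (u : deficiencySpace τ Complex.I), (u : H) = G τ Complex.I x →
          Complex.I • (LinearMap.ker P.toLinearMap)ᗮ.orthogonalProjectionOnto
            (ContinuousLinearMap.adjoint (G τ (-Complex.I)) ((U u : H) - cayley A u)) =
          -(LinearMap.ker P.toLinearMap)ᗮ.orthogonalProjectionOnto
            (gammaHat τ Complex.I (x + W x)) := by
        intro x u hu
        have h3 : (U u : H) - cayley A u = -G τ (-Complex.I) (x + W x) := by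
          rw [hU x u hu, hu, cayley_G_I hA, map_add]
          abel
        rw [h3, map_neg, adjoint_G_neg_I hA, ← map_smul, smul_neg, smul_smul, mul_neg,
          Complex.I_mul_I, neg_neg, one_smul, map_neg]
      rw [hΘg]
      constructor
      · rintro ⟨x, hζ, rfl⟩
        let u : deficiencySpace τ Complex.I :=
          ⟨G τ Complex.I x, G_mem_deficiencySpace hA hN hI x⟩
        exact ⟨u, by rw [h1 x u rfl, hζ], (h2 x u rfl).symm⟩
      · rintro ⟨u, hu, rfl⟩
        obtain ⟨x, hx⟩ := (range_G hA hτ hN hI).ge u.2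
        refine ⟨x, G_injective hA hτ hN hI' ?_, h2 x u hx.symm⟩
        rw [← hu, h1 x u hx.symm]
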